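/- Let $n\ge 0$, $T>0$, and let $P:[0,T]\to \mathrm{Mat}_n(\mathbb R)$ be a $C^1$ path of symmetric invertible matrices (possibly indefinite, possibly non-constant) with $P(0)=P(T)$. For $s_0\in\mathbb R$ consider the equation $-(P(t)x')'+s_0P(t)x=0$. With $z=(Px',x)$ it becomes the linear Hamiltonian system $$z'(t)=J\,B_{0,s_0}(t)\,z(t),\qquad t\in[0,T],\qquad J=\begin{pmatrix}0&-I\\ I&0\end{pmatrix},\qquad B_{0,s_0}(t)=\begin{pmatrix}P(t)^{-1}&0\\ 0&-s_0P(t)\end{pmatrix}.$$ Let $\psi_{0,s_0}:[0,T]\to \mathrm{Sp}(2n,\mathbb R)$ be its fundamental solution, so that $\psi_{0,s_0}(0)=I$. Equip $\mathbb R^{2n}\times\mathbb R^{2n}$ with the symplectic form $(-\omega)\times\omega$, where $\omega(z,w)=\langle Jz,w\rangle$, and with the corresponding complex structure $\mathcal J=(-J)\oplus J$. For $M\in\mathrm{Sp}(2n,\mathbb R)$ let $\mathrm{Gr}(M)=\{(x,Mx)\}$ be its graph, which is a Lagrangian subspace, and let $\Delta=\mathrm{Gr}(I)$. For a Lagrangian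 subspace $L_0$ and a continuous path $\ell$ of Lagrangian subspaces on $[a,b]$, let $$\iota_{\mathrm{CLM}}(L_0,\ell(t),t\in[a,b])=[e^{-\varepsilon\mathcal J}\ell:\Sigma(L_0)],\qquad 0<\varepsilon\ll1,$$ be the intersection number with the Maslov cycle $\Sigma(L_0)=\{L \text{ Lagrangian}: L\cap L_0\neq0\}$, co-oriented by the paths $\theta\mapsto e^{\theta\mathcal J}L$. Then there is a $\sigma\in\mathbb R$ (which may depend on $P$ and $T$) such that for every $s_0\ge\sigma$ the fundamental solution exists and $$\iota_{\mathrm{CLM}}\big(\Delta,\mathrm{Gr}(\psi_{0,s_0}(t)),t\in[0,T]\big)=n .$$ -/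

import Mathlib

open Set Filter Topology

noncomputable section

/-- Index set of the phase space `ℝ²ⁿ ∋ z = (y, u)`: momentum `y` first, position `u` second. -/
abbrev Ph (n : ℕ) : Type := Fin n ⊕ Fin n

/-- The symplectic space `ℝ²ⁿ × ℝ²ⁿ`, with its Euclidean inner product. -/
abbrev DblSpace (n : ℕ) : Type := EuclideanSpace ℝ (Ph n ⊕ Ph n)

/-- The complex structure `(-J) ⊕ J` of `ℝ²ⁿ × ℝ²ⁿ`, where `J = [[0, -I], [I, 0]]`
(this is Mathlib's `Matrix.J`). -/
def dblJ (n : ℕ) : Matrix (Ph n ⊕ Ph n) (Ph n ⊕ Ph n) ℝ :=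
  Matrix.fromBlocks (-Matrix.J (Fin n) ℝ) 0 0 (Matrix.J (Fin n) ℝ)

/-- The symplectic form `(-ω) × ω` of `ℝ²ⁿ × ℝ²ⁿ`, where `ω(z, w) = ⟨J z, w⟩`. -/
def dblForm {n : ℕ} (z w : DblSpace n) : ℝ :=
  inner ℝ (Matrix.toEuclideanLin (dblJ n) z) w

/-- A subspace is Lagrangian when it equals its own symplectic orthogonal. -/
def IsLagrangian {n : ℕ} (L : Submodule ℝ (DblSpace n)) : Prop :=
  ∀ z : DblSpace n, z ∈ L ↔ ∀ w ∈ L, dblForm z w = 0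

/-- The graph `Gr(M) = {(x, M x)}`. The diagonal `Δ` is `Gr(I)`. -/
def graphOf {n : ℕ} (M : Matrix (Ph n) (Ph n) ℝ) : Submodule ℝ (DblSpace n) :=
  LinearMap.range (Matrix.toEuclideanLin (Matrix.fromRows 1 M))

/-- The rotated subspace `e^{-ε𝒥} L`, where `𝒥` is the complex structure `dblJ`; since `𝒥² = -I`,
the exponential is `cos ε - sin ε 𝒥`. -/
def rotateBack {n : ℕ} (ε : ℝ) (L : Submodule ℝ (DblSpace n)) : Submodule ℝ (DblSpace n) :=
  L.map (Matrix.toEuclideanLin (Real.cos ε • 1 - Real.sin ε • dblJ n))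

/-- A continuous path of Lagrangian subspaces on `[a, b]`. The topology of the Lagrangian
Grassmannian is that of the orthogonal projections. -/
def IsLagrangianPath {n : ℕ} (ℓ : ℝ → Submodule ℝ (DblSpace n)) (a b : ℝ) : Prop :=
  (∀ t ∈ Icc a b, IsLagrangian (ℓ t)) ∧
    ContinuousOn (fun t => (ℓ t).starProjection) (Icc a b)

/-- The matrix of the orthogonal reflection `R_L = 2 Π_L - I` in the subspace `L`. -/
def reflMatrix {n : ℕ} (L : Submodule ℝ (DblSpace n)) :
    Matrix (Ph n ⊕ Ph n) (Ph n ⊕ Ph n) ℝ :=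
  Matrix.toEuclideanLin.symm (2 • (L.starProjection : DblSpace n →ₗ[ℝ] DblSpace n) - 1)

/-- The Souriau unitary of the pair `(L₀, L)`, with sign. For Lagrangian `L₀`, `L` the map
`S = R_L R_{L₀}` commutes with `𝒥`, so it is a unitary map of the complex vector space
`(ℝ²ⁿ × ℝ²ⁿ, 𝒥)`; the multiplicity of its eigenvalue `1` is `dim (L ∩ L₀)`, and it turns into
`e^{2iθ} S` when `L` is replaced by `e^{θ𝒥} L`.

The complex space `(ℝ²ⁿ × ℝ²ⁿ, 𝒥)` is identified with the `i`-eigenspace of `𝒥` in the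
complexification, and `p = (I - i𝒥) / 2` is the projection onto that eigenspace. The matrix below
acts as `-S` on the `i`-eigenspace and as the identity on the `(-i)`-eigenspace. Thus its
eigenvalues are the numbers `-λ`, for the `2n` eigenvalues `λ` of `S`, together with `2n` times
the number `1`. -/
def souriau {n : ℕ} (L₀ L : Submodule ℝ (DblSpace n)) :
    Matrix (Ph n ⊕ Ph n) (Ph n ⊕ Ph n) ℂ :=
  let p : Matrix (Ph n ⊕ Ph n) (Ph n ⊕ Ph n) ℂ :=
    (1 / 2 : ℂ) • (1 - Complex.I • (dblJ n).map Complex.ofReal)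
  (1 - p) - (reflMatrix L * reflMatrix L₀).map Complex.ofReal * p

/-- The sum of the principal arguments (in `(-π, π]`) of the eigenvalues, with multiplicity. -/
def argSum {ι : Type*} [Fintype ι] [DecidableEq ι] (K : Matrix ι ι ℂ) : ℝ :=
  (K.charpoly.roots.map Complex.arg).sum

/-- `k` is the intersection number `[ℓ : Σ(L₀)]` of a continuous Lagrangian path `ℓ`, whose
endpoints are transversal to `L₀`, with the Maslov cycle
`Σ(L₀) = {L Lagrangian | L ∩ L₀ ≠ 0}`, co-oriented by the paths `θ ↦ e^{θ𝒥} L`.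

The path meets `Σ(L₀)` exactly when an eigenvalue of `souriau L₀ (ℓ t)` is `-1`, and the
co-orientation is the counterclockwise direction. So the intersection number is the number of
eigenvalues that pass through `-1` counterclockwise minus the number of those that pass clockwise.
If `θ_j(t)` are continuous arguments of the eigenvalues and `φ = ∑ θ_j` (a continuous argument of
the determinant), each passage changes `θ_j - arg e^{iθ_j}` by `2π`, with the sign of the passage,
and so the number is the total increase of `φ - ∑ arg e^{iθ_j}`, divided by `2π`. -/
def HasIntersectionNumber {n : ℕ} (L₀ : Submodule ℝ (DblSpace n))
    (ℓ : ℝ → Submodule ℝ (DblSpace n)) (a b : ℝ) (k : ℤ) : Prop :=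
  IsLagrangian L₀ ∧ IsLagrangianPath ℓ a b ∧ ℓ a ⊓ L₀ = ⊥ ∧ ℓ b ⊓ L₀ = ⊥ ∧
    ∃ φ : ℝ → ℝ, ContinuousOn φ (Icc a b) ∧
      (∀ t ∈ Icc a b, (souriau L₀ (ℓ t)).det = Complex.exp (φ t * Complex.I)) ∧
      2 * Real.pi * k =
        (φ b - argSum (souriau L₀ (ℓ b))) - (φ a - argSum (souriau L₀ (ℓ a)))

/-- `ι_CLM(L₀, ℓ(t), t ∈ [a, b]) = k`, that is, `[e^{-ε𝒥} ℓ(t) : Σ(L₀)] = k` for all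
sufficiently small `ε > 0`. -/
def HasCLMIndex {n : ℕ} (L₀ : Submodule ℝ (DblSpace n))
    (ℓ : ℝ → Submodule ℝ (DblSpace n)) (a b : ℝ) (k : ℤ) : Prop :=
  ∀ᶠ ε in 𝓝[>] (0 : ℝ), HasIntersectionNumber L₀ (fun t => rotateBack ε (ℓ t)) a b k

/-- The coefficient matrix `B(t) = [[P(t)⁻¹, 0], [0, -s P(t)]]` of the Hamiltonian system
`z' = J B(t) z` of the equation `-(P x')' + s P x = 0`, where `z = (P x', x)`. -/
def hamMatrix {n : ℕ} (P : ℝ → Matrix (Fin n) (Fin n) ℝ) (s t : ℝ) :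
    Matrix (Ph n) (Ph n) ℝ :=
  Matrix.fromBlocks (P t)⁻¹ 0 0 (-(s • P t))

/-- `ψ` is the fundamental solution on `[0, T]` of `z' = J B(t) z`: it satisfies
`ψ' = J B ψ` (derivative entry by entry) and `ψ(0) = I`. -/
def IsFundamentalSolution {n : ℕ} (P : ℝ → Matrix (Fin n) (Fin n) ℝ) (s T : ℝ)
    (ψ : ℝ → Matrix (Ph n) (Ph n) ℝ) : Prop :=
  ψ 0 = 1 ∧ ∀ t ∈ Icc 0 T, ∀ i j,
    HasDerivWithinAt (fun r => ψ r i j)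
      ((Matrix.J (Fin n) ℝ * hamMatrix P s t * ψ t) i j) (Icc 0 T) t

/-- The intersection number is unique: it does not depend on the continuous argument. -/
theorem HasIntersectionNumber.unique {n : ℕ} {L₀ : Submodule ℝ (DblSpace n)}
    {ℓ : ℝ → Submodule ℝ (DblSpace n)} {a b : ℝ} (hab : a ≤ b) {k l : ℤ}
    (hk : HasIntersectionNumber L₀ ℓ a b k) (hl : HasIntersectionNumber L₀ ℓ a b l) : k = l := by
  obtain ⟨-, -, -, -, φ, hφ, hφd, hφk⟩ := hk
  obtain ⟨-, -, -, -, χ, hχ, hχd, hχl⟩ := hl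
  have hpi : (0 : ℝ) < 2 * Real.pi := by positivity
  have hint : ∀ t ∈ Icc a b, ∃ m : ℤ, (φ t - χ t) / (2 * Real.pi) = m := by
    intro t ht
    have h := (hφd t ht).symm.trans (hχd t ht)
    rw [Complex.exp_eq_exp_iff_exists_int] at h
    obtain ⟨m, hm⟩ := h
    refine ⟨m, ?_⟩
    have h2 : (φ t : ℂ) = χ t + m * (2 * Real.pi) := by
      have : (φ t : ℂ) * Complex.I = (χ t + m * (2 * Real.pi)) * Complex.I := by
        rw [hm]; ring
      exact mul_right_cancel₀ Complex.I_ne_zero this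
    have h3 : φ t = χ t + m * (2 * Real.pi) := by exact_mod_cast h2
    rw [h3]; field_simp; ring
  have hc : ContinuousOn (fun t => (φ t - χ t) / (2 * Real.pi)) (Icc a b) :=
    (hφ.sub hχ).div_const _
  have hconst : (φ a - χ a) / (2 * Real.pi) = (φ b - χ b) / (2 * Real.pi) :=
    isPreconnected_Icc.constant_of_mapsTo (T := range ((↑) : ℤ → ℝ))
      Int.isClosedEmbedding_coe_real.isEmbedding.isDiscrete_range hc
      (fun t ht => (hint t ht).imp fun _ h => h.symm) (left_mem_Icc.2 hab) (right_mem_Icc.2 hab)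
  have hd : φ a - χ a = φ b - χ b := by
    field_simp at hconst; exact hconst
  have : (2 * Real.pi) * (k : ℝ) = (2 * Real.pi) * l := by rw [hφk, hχl]; linarith
  exact_mod_cast mul_left_cancel₀ hpi.ne' this

end

/-!
The quadratic form `q_t (y, x) = ⟨y, P t x⟩` is the reason for the value `n`. Along the flow its
derivative is `|y|² + s |P x|² + ⟨y, P' x⟩`, which is positive for large `s`
(`exists_threshold_isExpanding`), so the fundamental solution `ψ t` strictly increases `q_0` into
`q_t` for `t > 0`. This is all that is used of the equation, apart from the symplecticity of `ψ t`.
In particular `1` is not an eigenvalue of `ψ T`, since `q_T = q_0`.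

The index compares two numbers. The Souriau matrix of the diagonal and of `e^{-ε𝒥} Gr (M)` is
similar to `-e^{-2iε} N N̄⁻¹ ⊕ 1`, where `N = holoPart M` (`souriau_rotateBack_graphOf`), so its
determinant has the argument `2 arg det N - 4nε`. If `1` is not an eigenvalue of `M`, then
`M + 1 = H J (M - 1)` with `H` symmetric (`exists_isSymm_cayley`), and the eigenvalues of
`-N N̄⁻¹` are `(1 + i h) / (1 - i h)` for the eigenvalues `h` of `H`, so for small `ε` the principal
arguments add up to `∑ (2 arg (1 + i h) - 2ε)` at `M = ψ T`. At `M = 1` all the `2n` relevant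
eigenvalues are `-e^{-2iε}`, with the principal argument `π - 2ε`. Hence the index is `n` as soon
as `arg det holoPart (ψ t)` increases by `∑ arg (1 + i h)` over `[0, T]` (`hasCLMIndex_of_log`).

This increase is found by two deformations (`exists_log_det_pairMatrix`). Let
`β_t (s) = s P t + (1 - s) i`, for `0 ≤ s ≤ 1`. The matrix with the block rows `(1, β_t) ψ t` and
`(1, -β_0)` is never singular: for `t > 0`, a kernel vector would start where `q_0 ≥ 0` and end
where `q_t ≤ 0`, and for `t = 0`, where `ψ 0 = 1`, it would have a component in the kernel of `β_0`,
which is zero. At `s = 0` its determinant is a constant multiple of `det holoPart (ψ t)`, and at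
`s = 1` it is real, so that the increase over `[0, T]` is read off from the edges `t = 0` and
`t = T` of the rectangle. These two edges occur also, up to constants, as the edges `τ = 0` and
`τ = 1` of a second square, the determinants of `L' (ψ T - 1) + τ L (ψ T + 1)` of `cayleyMatrix`,
which is nonsingular for a similar reason; this is where `P T = P 0` enters. It is real at `s = 1`,
and at `s = 0` it is a constant multiple of `det (1 + i τ H)`, whose argument increases by
`∑ arg (1 + i h)` from `τ = 0` to `τ = 1`.
-/

noncomputable section

open Matrix

/-! ### Continuous logarithms -/

/-- A continuous nonvanishing function on a rectangle has a continuous logarithm. -/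
theorem exists_continuousOn_log_prod {f : ℝ × ℝ → ℂ} {a b c d : ℝ} (hab : a ≤ b) (hcd : c ≤ d)
    (hf : ContinuousOn f (Icc a b ×ˢ Icc c d)) (h0 : ∀ p ∈ Icc a b ×ˢ Icc c d, f p ≠ 0) :
    ∃ g : ℝ × ℝ → ℂ, ContinuousOn g (Icc a b ×ˢ Icc c d) ∧
      ∀ p ∈ Icc a b ×ˢ Icc c d, Complex.exp (g p) = f p := by
  -- Retracting the plane onto the rectangle gives a function on a simply connected open set.
  let r : ℝ × ℝ → ℝ × ℝ := fun p => (projIcc a b hab p.1, projIcc c d hcd p.2)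
  have hr : Continuous r := by
    have h1 := (continuous_projIcc (h := hab)).comp (continuous_fst (X := ℝ) (Y := ℝ))
    have h2 := (continuous_projIcc (h := hcd)).comp (continuous_snd (X := ℝ) (Y := ℝ))
    exact (continuous_subtype_val.comp h1).prodMk (continuous_subtype_val.comp h2)
  have hm : ∀ p, r p ∈ Icc a b ×ˢ Icc c d := fun p => ⟨Subtype.coe_prop _, Subtype.coe_prop _⟩
  have hid : ∀ p ∈ Icc a b ×ˢ Icc c d, r p = p := by
    rintro ⟨x, y⟩ ⟨hx, hy⟩
    simp only [r, projIcc_of_mem hab hx, projIcc_of_mem hcd hy]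
  have hsc : IsSimplyConnected (univ : Set (ℝ × ℝ)) := by
    have : ContractibleSpace (univ : Set (ℝ × ℝ)) := convex_univ.contractibleSpace univ_nonempty
    exact (inferInstance : SimplyConnectedSpace (univ : Set (ℝ × ℝ)))
  obtain ⟨g, hg, hge⟩ := Complex.exists_continuousOn_eqOn_exp_comp hsc isOpen_univ
    (g := f ∘ r) (hf.comp hr.continuousOn fun p _ => hm p)
    (by rintro ⟨p, -, hp⟩; exact h0 _ (hm p) hp)
  refine ⟨g, hg.mono (subset_univ _), fun p hp => ?_⟩
  have := hge (mem_univ p)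
  simpa [hid p hp] using this

/-- A continuous function whose exponential is constant is constant. -/
theorem eq_of_exp_eq_const {h : ℝ → ℂ} {a b : ℝ} (hab : a ≤ b) (hc : ContinuousOn h (Icc a b))
    {w : ℂ} (hw : ∀ t ∈ Icc a b, Complex.exp (h t) = w) : h b = h a := by
  have hint : ∀ t ∈ Icc a b, ∃ m : ℤ, h t = h a + m * (2 * Real.pi * Complex.I) := fun t ht =>
    Complex.exp_eq_exp_iff_exists_int.1 ((hw t ht).trans (hw a (left_mem_Icc.2 hab)).symm)
  have hpi : (2 * Real.pi : ℝ) ≠ 0 := by positivity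
  have hconst : (h a).im / (2 * Real.pi) - (h a).im / (2 * Real.pi)
      = (h b).im / (2 * Real.pi) - (h a).im / (2 * Real.pi) :=
    isPreconnected_Icc.constant_of_mapsTo (T := range ((↑) : ℤ → ℝ))
      (f := fun t => (h t).im / (2 * Real.pi) - (h a).im / (2 * Real.pi))
      Int.isClosedEmbedding_coe_real.isEmbedding.isDiscrete_range
      (((Complex.continuous_im.comp_continuousOn hc).div_const _).sub continuousOn_const)
      (fun t ht => by
        obtain ⟨m, hm⟩ := hint t ht
        refine ⟨m, ?_⟩
        simp only [hm]
        simp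
        field_simp
        ring) (left_mem_Icc.2 hab) (right_mem_Icc.2 hab)
  obtain ⟨m, hm⟩ := hint b (right_mem_Icc.2 hab)
  have him : (h b).im = (h a).im := by
    have := hconst
    field_simp at this
    linarith
  have : (m : ℝ) * (2 * Real.pi) = 0 := by
    rw [hm] at him
    simpa using him
  have hm0 : (m : ℝ) = 0 := (mul_eq_zero.1 this).resolve_right hpi
  rw [hm]
  simp [show m = 0 by exact_mod_cast hm0]

/-- A continuous logarithm of a real-valued function has constant imaginary part. -/
theorem im_eq_of_exp_im_eq_zero {h : ℝ → ℂ} {a b : ℝ} (hab : a ≤ b)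
    (hc : ContinuousOn h (Icc a b)) (hw : ∀ t ∈ Icc a b, (Complex.exp (h t)).im = 0) :
    (h b).im = (h a).im := by
  have := eq_of_exp_eq_const (h := fun t => h t - starRingEnd ℂ (h t)) (w := 1) hab
    (hc.sub (Complex.continuous_conj.comp_continuousOn hc)) (fun t ht => by
      rw [Complex.exp_sub, Complex.exp_conj, Complex.conj_eq_iff_im.2 (hw t ht)]
      exact div_self (Complex.exp_ne_zero _))
  have := congrArg Complex.im this
  simp at this
  linarith

/-- Two continuous logarithms of proportional functions have the same increment. -/
theorem sub_eq_sub_of_exp_eq_mul {g h : ℝ → ℂ} {a b : ℝ} (hab : a ≤ b)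
    (hg : ContinuousOn g (Icc a b)) (hh : ContinuousOn h (Icc a b)) {w : ℂ}
    (hw : ∀ t ∈ Icc a b, Complex.exp (g t) = w * Complex.exp (h t)) :
    g b - g a = h b - h a := by
  have := eq_of_exp_eq_const (h := fun t => g t - h t) (w := w) hab (hg.sub hh) (fun t ht => by
      rw [Complex.exp_sub, hw t ht]
      exact mul_div_cancel_right₀ _ (Complex.exp_ne_zero _))
  linear_combination this

/-! ### Complexification -/

section Cone

variable {ι κ μ : Type*}

/-- The complexification of a real matrix. -/
def cplx (M : Matrix ι κ ℝ) : Matrix ι κ ℂ := M.map Complex.ofReal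

@[simp] theorem cplx_apply (M : Matrix ι κ ℝ) (i : ι) (j : κ) : cplx M i j = M i j := rfl

@[simp] theorem cplx_one [DecidableEq ι] : cplx (1 : Matrix ι ι ℝ) = 1 :=
  Matrix.map_one _ Complex.ofReal_zero Complex.ofReal_one

@[simp] theorem cplx_zero : cplx (0 : Matrix ι κ ℝ) = 0 := Matrix.map_zero _ Complex.ofReal_zero

theorem cplx_add (M N : Matrix ι κ ℝ) : cplx (M + N) = cplx M + cplx N :=
  Matrix.map_add _ Complex.ofReal_add M N

theorem cplx_sub (M N : Matrix ι κ ℝ) : cplx (M - N) = cplx M - cplx N :=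
  Matrix.map_sub _ Complex.ofReal_sub M N

theorem cplx_neg (M : Matrix ι κ ℝ) : cplx (-M) = -cplx M := by ext; simp

theorem cplx_smul (r : ℝ) (M : Matrix ι κ ℝ) : cplx (r • M) = (r : ℂ) • cplx M := by ext; simp

theorem cplx_mul [Fintype κ] (M : Matrix ι κ ℝ) (N : Matrix κ μ ℝ) :
    cplx (M * N) = cplx M * cplx N :=
  Matrix.map_mul (f := Complex.ofRealHom)

theorem det_cplx [Fintype ι] [DecidableEq ι] (M : Matrix ι ι ℝ) : (cplx M).det = (M.det : ℂ) :=
  (RingHom.map_det Complex.ofRealHom M).symm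

theorem conjTranspose_cplx (M : Matrix ι κ ℝ) : (cplx M)ᴴ = cplx Mᵀ := by ext; simp

theorem cplx_fromBlocks {m₁ m₂ n₁ n₂ : Type*} (A : Matrix m₁ n₁ ℝ) (B : Matrix m₁ n₂ ℝ)
    (C : Matrix m₂ n₁ ℝ) (D : Matrix m₂ n₂ ℝ) :
    cplx (fromBlocks A B C D) = fromBlocks (cplx A) (cplx B) (cplx C) (cplx D) :=
  fromBlocks_map ..

theorem continuous_cplx : Continuous (cplx : Matrix ι κ ℝ → Matrix ι κ ℂ) :=
  Continuous.matrix_map continuous_id Complex.continuous_ofReal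

/-! ### The indefinite form and expanding matrices -/

theorem eq_zero_of_comp_eq_zero {z : ι ⊕ ι → ℂ} (h1 : z ∘ Sum.inl = 0) (h2 : z ∘ Sum.inr = 0) :
    z = 0 := by
  ext i
  rcases i with i | i
  · exact congrFun h1 i
  · exact congrFun h2 i

variable [Fintype ι]

/-- The quadratic form `Re ⟨y, P x⟩` at the vector `(y, x)` of the complexified phase space. -/
def coneForm (P : Matrix ι ι ℝ) (z : ι ⊕ ι → ℂ) : ℝ :=
  (star (z ∘ Sum.inl) ⬝ᵥ (cplx P *ᵥ (z ∘ Sum.inr))).re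

/-- `M` strictly increases the form of `P₀` into the form of `P`, on nonzero vectors. -/
def IsExpanding (P₀ P : Matrix ι ι ℝ) (M : Matrix (ι ⊕ ι) (ι ⊕ ι) ℝ) : Prop :=
  ∀ z : ι ⊕ ι → ℂ, z ≠ 0 → coneForm P₀ z < coneForm P (cplx M *ᵥ z)

theorem im_star_dotProduct_cplx {P : Matrix ι ι ℝ} (hP : P.IsSymm) (x : ι → ℂ) :
    (star x ⬝ᵥ (cplx P *ᵥ x)).im = 0 := by
  have h : (cplx P).IsHermitian := by
    rw [Matrix.IsHermitian, conjTranspose_cplx, hP.eq]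
  simpa using h.im_star_dotProduct_mulVec_self x

open scoped ComplexOrder in
theorem re_star_dotProduct_self_nonneg (x : ι → ℂ) : 0 ≤ (star x ⬝ᵥ x).re := by
  exact (Complex.le_def.1 (dotProduct_star_self_nonneg x)).1

open scoped ComplexOrder in
theorem eq_zero_of_re_star_dotProduct_self {x : ι → ℂ} (h : (star x ⬝ᵥ x).re = 0) : x = 0 := by
  have h3 := (Complex.le_def.1 (dotProduct_star_self_nonneg x)).2
  exact dotProduct_star_self_eq_zero.1 (Complex.ext h h3.symm)

theorem inl_fromBlocks_mulVec (A B C D : Matrix ι ι ℂ) (z : ι ⊕ ι → ℂ) :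
    (fromBlocks A B C D *ᵥ z) ∘ Sum.inl = A *ᵥ (z ∘ Sum.inl) + B *ᵥ (z ∘ Sum.inr) := by
  rw [fromBlocks_mulVec]; rfl

theorem inr_fromBlocks_mulVec (A B C D : Matrix ι ι ℂ) (z : ι ⊕ ι → ℂ) :
    (fromBlocks A B C D *ᵥ z) ∘ Sum.inr = C *ᵥ (z ∘ Sum.inl) + D *ᵥ (z ∘ Sum.inr) := by
  rw [fromBlocks_mulVec]; rfl

variable [DecidableEq ι]

/-- The segment `s P + (1 - s) i` from the scalar matrix `i` to `P`. -/
def pathToI (P : Matrix ι ι ℝ) (s : ℝ) : Matrix ι ι ℂ :=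
  (s : ℂ) • cplx P + ((1 - s : ℝ) : ℂ) • (Complex.I • 1)

theorem pathToI_mulVec (P : Matrix ι ι ℝ) (s : ℝ) (x : ι → ℂ) :
    pathToI P s *ᵥ x = (s : ℂ) • (cplx P *ᵥ x) + (((1 - s : ℝ) : ℂ) * Complex.I) • x := by
  simp [pathToI, add_mulVec, smul_mulVec, smul_smul]

/-- `Re ⟨β x, P x⟩ = s |P x|²` for `β = s P + (1 - s) i`. -/
theorem re_star_pathToI {P : Matrix ι ι ℝ} (hP : P.IsSymm) (s : ℝ) (x : ι → ℂ) :
    (star (pathToI P s *ᵥ x) ⬝ᵥ (cplx P *ᵥ x)).re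
      = s * (star (cplx P *ᵥ x) ⬝ᵥ (cplx P *ᵥ x)).re := by
  rw [pathToI_mulVec]
  simp [add_dotProduct, smul_dotProduct, im_star_dotProduct_cplx hP]

theorem re_star_pathToI_nonneg {P : Matrix ι ι ℝ} (hP : P.IsSymm) {s : ℝ} (hs : 0 ≤ s)
    (x : ι → ℂ) : 0 ≤ (star (pathToI P s *ᵥ x) ⬝ᵥ (cplx P *ᵥ x)).re := by
  rw [re_star_pathToI hP]
  exact mul_nonneg hs (re_star_dotProduct_self_nonneg _)

theorem pathToI_mulVec_eq_zero {P : Matrix ι ι ℝ} (hP : P.IsSymm) (hdet : P.det ≠ 0) {s : ℝ}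
    {x : ι → ℂ} (h : pathToI P s *ᵥ x = 0) : x = 0 := by
  have h1 := re_star_pathToI hP s x
  rw [h] at h1
  simp only [star_zero, zero_dotProduct, Complex.zero_re, zero_eq_mul] at h1
  rcases h1 with rfl | h1
  · simpa [pathToI_mulVec] using h
  · have h2 : cplx P *ᵥ x = 0 := eq_zero_of_re_star_dotProduct_self h1
    by_contra hx
    exact hdet (by
      have := exists_mulVec_eq_zero_iff.1 ⟨x, hx, h2⟩
      rwa [det_cplx, Complex.ofReal_eq_zero] at this)

/-- `1` is not an eigenvalue of a matrix that expands a form. -/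
theorem IsExpanding.det_sub_one_ne_zero {P : Matrix ι ι ℝ} {M : Matrix (ι ⊕ ι) (ι ⊕ ι) ℝ}
    (hM : IsExpanding P P M) : (M - 1).det ≠ 0 := by
  intro h
  have : (cplx (M - 1)).det = 0 := by rw [det_cplx, h, Complex.ofReal_zero]
  obtain ⟨z, hz, h0⟩ := exists_mulVec_eq_zero_iff.2 this
  rw [cplx_sub, sub_mulVec, sub_eq_zero, cplx_one, one_mulVec] at h0
  have := hM z hz
  rw [h0] at this
  exact lt_irrefl _ this

/-! ### Two families of nonsingular matrices -/

/-- The matrix with block rows `(1, β) M` and `(1, -β₀)`. -/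
def pairMatrix (b₀ b : Matrix ι ι ℂ) (M : Matrix (ι ⊕ ι) (ι ⊕ ι) ℂ) : Matrix (ι ⊕ ι) (ι ⊕ ι) ℂ :=
  fromBlocks 1 b 0 0 * M + fromBlocks 0 0 1 (-b₀)

theorem pairMatrix_mulVec_eq_zero {b₀ b : Matrix ι ι ℂ} {M : Matrix (ι ⊕ ι) (ι ⊕ ι) ℂ}
    {z : ι ⊕ ι → ℂ} (h : pairMatrix b₀ b M *ᵥ z = 0) :
    (M *ᵥ z) ∘ Sum.inl = -(b *ᵥ ((M *ᵥ z) ∘ Sum.inr)) ∧ z ∘ Sum.inl = b₀ *ᵥ (z ∘ Sum.inr) := by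
  rw [pairMatrix, add_mulVec, ← mulVec_mulVec] at h
  have h1 := congrArg (fun v : ι ⊕ ι → ℂ => v ∘ Sum.inl) h
  have h2 := congrArg (fun v : ι ⊕ ι → ℂ => v ∘ Sum.inr) h
  simp only [Pi.add_comp, inl_fromBlocks_mulVec, inr_fromBlocks_mulVec, one_mulVec, zero_mulVec,
    neg_mulVec, Pi.zero_comp, add_zero, zero_add] at h1 h2
  exact ⟨eq_neg_of_add_eq_zero_left h1, by rwa [← sub_eq_add_neg, sub_eq_zero] at h2⟩

/-- A kernel vector would start in a subspace where the form of `P₀` is nonnegative and end in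
one where the form of `P` is nonpositive. -/
theorem IsExpanding.det_pairMatrix_ne_zero {P₀ P : Matrix ι ι ℝ} (hP₀ : P₀.IsSymm)
    (hP : P.IsSymm) {M : Matrix (ι ⊕ ι) (ι ⊕ ι) ℝ} (hM : IsExpanding P₀ P M) {s : ℝ}
    (hs : 0 ≤ s) : (pairMatrix (pathToI P₀ s) (pathToI P s) (cplx M)).det ≠ 0 := by
  intro h
  obtain ⟨z, hz, h0⟩ := exists_mulVec_eq_zero_iff.2 h
  obtain ⟨h1, h2⟩ := pairMatrix_mulVec_eq_zero h0
  have h3 := hM z hz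
  rw [coneForm, coneForm, h1, h2] at h3
  have h4 := re_star_pathToI_nonneg hP₀ hs (z ∘ Sum.inr)
  have h5 := re_star_pathToI_nonneg hP hs ((cplx M *ᵥ z) ∘ Sum.inr)
  simp only [star_neg, neg_dotProduct, Complex.neg_re] at h3
  linarith

theorem det_pairMatrix_one_ne_zero {P : Matrix ι ι ℝ} (hP : P.IsSymm) (hdet : P.det ≠ 0)
    (s : ℝ) : (pairMatrix (pathToI P s) (pathToI P s) 1).det ≠ 0 := by
  intro h
  obtain ⟨z, hz, h0⟩ := exists_mulVec_eq_zero_iff.2 h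
  obtain ⟨h1, h2⟩ := pairMatrix_mulVec_eq_zero h0
  rw [one_mulVec] at h1
  have h3 : pathToI P s *ᵥ (z ∘ Sum.inr) = 0 := by
    rw [h2] at h1
    exact self_eq_neg.1 h1
  refine hz (eq_zero_of_comp_eq_zero (by rw [h2, h3]) (pathToI_mulVec_eq_zero hP hdet h3))

/-- The matrix `L' (M - 1) + τ L (M + 1)`, where `L` has the block rows `(1, β)`, `(1, -β)` and
`L'` the block rows `(1, β)`, `(-1, β)`. For `τ = 1` it is twice `pairMatrix β β M`. -/
def cayleyMatrix (b : Matrix ι ι ℂ) (τ : ℝ) (M : Matrix (ι ⊕ ι) (ι ⊕ ι) ℂ) :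
    Matrix (ι ⊕ ι) (ι ⊕ ι) ℂ :=
  fromBlocks 1 b (-1) b * (M - 1) + (τ : ℂ) • (fromBlocks 1 b 1 (-b) * (M + 1))

theorem cayleyMatrix_one (b : Matrix ι ι ℂ) (M : Matrix (ι ⊕ ι) (ι ⊕ ι) ℂ) :
    cayleyMatrix b 1 M = (2 : ℂ) • pairMatrix b b M := by
  have e1 : fromBlocks (1 : Matrix ι ι ℂ) b (-1) b =
      fromBlocks 1 b 0 0 + fromBlocks 0 0 (-1) b := by
    simp [fromBlocks_add]
  have e2 : fromBlocks (1 : Matrix ι ι ℂ) b 1 (-b) =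
      fromBlocks 1 b 0 0 - fromBlocks 0 0 (-1) b := by
    simp [sub_eq_add_neg, fromBlocks_neg, fromBlocks_add]
  have e3 : fromBlocks (0 : Matrix ι ι ℂ) 0 1 (-b) = -fromBlocks 0 0 (-1) b := by
    simp [fromBlocks_neg]
  rw [cayleyMatrix, pairMatrix, e1, e2, e3, Complex.ofReal_one, one_smul, two_smul]
  noncomm_ring

theorem cayleyMatrix_zero (b : Matrix ι ι ℂ) (M : Matrix (ι ⊕ ι) (ι ⊕ ι) ℂ) :
    cayleyMatrix b 0 M = fromBlocks 1 0 0 (-1) * pairMatrix b b 1 * (M - 1) := by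
  simp [cayleyMatrix, pairMatrix, fromBlocks_add, fromBlocks_multiply]

/-- With `w = (M - 1) z = (y, x)` and `v = (M + 1) z = (y', x')`, the form increases by
`Re (⟨y', P x⟩ + ⟨y, P x'⟩) / 2` from `z` to `M z`, and this is not positive on the kernel. -/
theorem IsExpanding.det_cayleyMatrix_ne_zero {P : Matrix ι ι ℝ} (hP : P.IsSymm)
    (hdet : P.det ≠ 0) {M : Matrix (ι ⊕ ι) (ι ⊕ ι) ℝ} (hM : IsExpanding P P M) {s τ : ℝ}
    (hs : 0 ≤ s) (hτ : 0 ≤ τ) : (cayleyMatrix (pathToI P s) τ (cplx M)).det ≠ 0 := by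
  intro h
  obtain ⟨z, hz, h0⟩ := exists_mulVec_eq_zero_iff.2 h
  rw [cayleyMatrix, add_mulVec, smul_mulVec, ← mulVec_mulVec, ← mulVec_mulVec, sub_mulVec,
    add_mulVec, one_mulVec] at h0
  set b := pathToI P s with hb
  set u := cplx M *ᵥ z with hu
  have h1 := congrArg (fun v : ι ⊕ ι → ℂ => v ∘ Sum.inl) h0
  have h2 := congrArg (fun v : ι ⊕ ι → ℂ => v ∘ Sum.inr) h0
  simp only [Pi.add_comp, Pi.smul_comp, inl_fromBlocks_mulVec, inr_fromBlocks_mulVec, one_mulVec,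
    neg_mulVec, Pi.zero_comp, Pi.sub_comp] at h1 h2
  have h3 := hM z hz
  rw [← hu, coneForm, coneForm] at h3
  set u₁ := u ∘ Sum.inl
  set u₂ := u ∘ Sum.inr
  set z₁ := z ∘ Sum.inl
  set z₂ := z ∘ Sum.inr
  -- the sum and the difference of the two block rows
  have h4 : b *ᵥ (u₂ - z₂) = -((τ : ℂ) • (u₁ + z₁)) := by
    linear_combination (norm := module) (1 / 2 : ℂ) • h1 + (1 / 2 : ℂ) • h2
  have h5 : u₁ - z₁ = -((τ : ℂ) • (b *ᵥ (u₂ + z₂))) := by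
    linear_combination (norm := module) (1 / 2 : ℂ) • h1 - (1 / 2 : ℂ) • h2
  rcases hτ.eq_or_lt with rfl | hτ
  · have h6 : u₂ - z₂ = 0 := pathToI_mulVec_eq_zero hP hdet (s := s) (by simpa using h4)
    have h7 : u₁ - z₁ = 0 := by simpa using h5
    rw [sub_eq_zero.1 h6, sub_eq_zero.1 h7] at h3
    exact lt_irrefl _ h3
  have h6 := re_star_pathToI_nonneg hP hs (u₂ - z₂)
  have h7 := re_star_pathToI_nonneg hP hs (u₂ + z₂)
  rw [← hb, h4] at h6
  have h8 : star u₁ ⬝ᵥ cplx P *ᵥ u₂ - star z₁ ⬝ᵥ cplx P *ᵥ z₂ = (1 / 2 : ℂ) *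
      (star (u₁ + z₁) ⬝ᵥ cplx P *ᵥ (u₂ - z₂) + star (u₁ - z₁) ⬝ᵥ cplx P *ᵥ (u₂ + z₂)) := by
    simp only [star_add, star_sub, mulVec_add, mulVec_sub, add_dotProduct, sub_dotProduct,
      dotProduct_add, dotProduct_sub]
    ring
  rw [h5] at h8
  have h9 := congrArg Complex.re h8
  simp only [star_neg, star_smul, neg_dotProduct, smul_dotProduct, smul_eq_mul] at h6 h9
  simp [-star_add] at h6 h9
  have h10 : (star (u₁ + z₁) ⬝ᵥ cplx P *ᵥ (u₂ - z₂)).re ≤ 0 := by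
    by_contra hc
    exact absurd h6 (not_le.2 (mul_pos hτ (not_le.1 hc)))
  have h11 := mul_nonneg hτ.le h7
  linarith

end Cone

/-! ### The increment of the argument -/

section Increment

variable {ι : Type*} [DecidableEq ι]

theorem pathToI_one (P : Matrix ι ι ℝ) : pathToI P 1 = cplx P := by
  simp [pathToI]

theorem pathToI_zero (P : Matrix ι ι ℝ) : pathToI P 0 = Complex.I • (1 : Matrix ι ι ℂ) := by
  simp [pathToI]

theorem continuous_pathToI :
    Continuous fun q : Matrix ι ι ℝ × ℝ => pathToI q.1 q.2 := by
  have h1 := (continuous_cplx (ι := ι) (κ := ι)).comp (continuous_fst (Y := ℝ))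
  have h2 : Continuous fun q : Matrix ι ι ℝ × ℝ => (q.2 : ℂ) :=
    Complex.continuous_ofReal.comp continuous_snd
  have h3 : Continuous fun q : Matrix ι ι ℝ × ℝ => ((1 - q.2 : ℝ) : ℂ) :=
    Complex.continuous_ofReal.comp (continuous_const.sub continuous_snd)
  exact (h2.smul h1).add (h3.smul continuous_const)

variable [Fintype ι]

theorem one_add_smul_of_diagonalization {κ : Type*} [Fintype κ] [DecidableEq κ]
    {H U V : Matrix κ κ ℂ} {d : κ → ℂ} (hVU : V * U = 1) (hH : H = U * diagonal d * V) (c : ℂ) :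
    1 + c • H = U * diagonal (fun j => 1 + c * d j) * V := by
  have h : diagonal (fun j => 1 + c * d j) = 1 + c • diagonal d := by
    rw [← diagonal_one, ← diagonal_smul, diagonal_add]
    rfl
  rw [h, mul_add, add_mul, mul_one, mul_eq_one_comm.1 hVU, hH, mul_smul_comm, smul_mul_assoc]

theorem det_one_add_smul_of_diagonalization {κ : Type*} [Fintype κ] [DecidableEq κ]
    {H U V : Matrix κ κ ℂ} {d : κ → ℂ} (hVU : V * U = 1) (hH : H = U * diagonal d * V) (c : ℂ) :
    (1 + c • H).det = ∏ j, (1 + c * d j) := by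
  rw [one_add_smul_of_diagonalization hVU hH, det_mul, det_mul, det_diagonal, mul_right_comm,
    ← det_mul, mul_eq_one_comm.1 hVU, det_one, one_mul]

theorem im_det_pairMatrix_cplx (P₀ P : Matrix ι ι ℝ) (M : Matrix (ι ⊕ ι) (ι ⊕ ι) ℝ) :
    (pairMatrix (cplx P₀) (cplx P) (cplx M)).det.im = 0 := by
  have : pairMatrix (cplx P₀) (cplx P) (cplx M)
      = cplx (fromBlocks 1 P 0 0 * M + fromBlocks 0 0 1 (-P₀)) := by
    simp [pairMatrix, cplx_add, cplx_mul, cplx_fromBlocks, cplx_neg]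
  rw [this, det_cplx, Complex.ofReal_im]

theorem continuous_pairMatrix {X : Type*} [TopologicalSpace X] {b₀ b : X → Matrix ι ι ℂ}
    {M : X → Matrix (ι ⊕ ι) (ι ⊕ ι) ℂ} (hb₀ : Continuous b₀) (hb : Continuous b)
    (hM : Continuous M) : Continuous fun x => pairMatrix (b₀ x) (b x) (M x) :=
  ((continuous_const.matrix_fromBlocks hb continuous_const continuous_const).matrix_mul hM).add
    (continuous_const.matrix_fromBlocks continuous_const continuous_const hb₀.neg)

theorem continuous_cayleyMatrix {X : Type*} [TopologicalSpace X] {b : X → Matrix ι ι ℂ}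
    {τ : X → ℝ} {M : X → Matrix (ι ⊕ ι) (ι ⊕ ι) ℂ} (hb : Continuous b) (hτ : Continuous τ)
    (hM : Continuous M) : Continuous fun x => cayleyMatrix (b x) (τ x) (M x) :=
  ((continuous_const.matrix_fromBlocks hb continuous_const hb).matrix_mul
    (hM.sub continuous_const)).add ((Complex.continuous_ofReal.comp hτ).smul
    ((continuous_const.matrix_fromBlocks hb continuous_const hb.neg).matrix_mul
      (hM.add continuous_const)))

theorem cayleyMatrix_I_eq {M H : Matrix (ι ⊕ ι) (ι ⊕ ι) ℝ}
    (hH : M + 1 = H * J ι ℝ * (M - 1)) (τ : ℝ) :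
    cayleyMatrix (Complex.I • 1) τ (cplx M) =
      pairMatrix (Complex.I • 1) (Complex.I • 1) 1 * (1 + (τ * Complex.I) • cplx H) *
        (-Complex.I • cplx (J ι ℝ)) * cplx (M - 1) := by
  have h1 : cplx M + 1 = cplx H * cplx (J ι ℝ) * cplx (M - 1) := by
    rw [← cplx_mul, ← cplx_mul, ← hH, cplx_add, cplx_one]
  have h2 : fromBlocks 1 (Complex.I • 1) (-1) (Complex.I • 1) =
      pairMatrix (Complex.I • 1) (Complex.I • 1) (1 : Matrix (ι ⊕ ι) (ι ⊕ ι) ℂ) *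
        (-Complex.I • cplx (J ι ℝ)) := by
    simp [pairMatrix, J, cplx_fromBlocks, cplx_neg, fromBlocks_add, fromBlocks_smul,
      fromBlocks_multiply, smul_smul, fromBlocks_neg]
  have h3 : fromBlocks 1 (Complex.I • 1) 1 (-(Complex.I • 1)) =
      pairMatrix (Complex.I • 1) (Complex.I • 1) (1 : Matrix (ι ⊕ ι) (ι ⊕ ι) ℂ) := by
    simp [pairMatrix, fromBlocks_add]
  have h4 : cplx M - 1 = cplx (M - 1) := by rw [cplx_sub, cplx_one]
  rw [cayleyMatrix, h1, h2, h3, h4]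
  have h5 : -Complex.I * τ * Complex.I = (τ : ℂ) := by
    linear_combination (-τ : ℂ) * Complex.I_mul_I
  simp only [mul_add, add_mul, mul_one, Matrix.mul_smul, Matrix.smul_mul, smul_smul, mul_assoc]
  simp only [← mul_assoc, h5]

theorem continuousOn_det_pairMatrix {P : ℝ → Matrix ι ι ℝ} {ψ : ℝ → Matrix (ι ⊕ ι) (ι ⊕ ι) ℝ}
    {A B : Set ℝ} (hP : ContinuousOn P A) (hψ : ContinuousOn ψ A) :
    ContinuousOn (fun p : ℝ × ℝ =>
      (pairMatrix (pathToI (P 0) p.2) (pathToI (P p.1) p.2) (cplx (ψ p.1))).det) (A ×ˢ B) := by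
  rw [continuousOn_iff_continuous_domRestrict] at *
  have h1 : Continuous fun p : A ×ˢ B => (⟨p.1.1, p.2.1⟩ : A) := by fun_prop
  have h2 : Continuous fun p : A ×ˢ B => p.1.2 := by fun_prop
  have hb : Continuous fun p : A ×ˢ B => pathToI (P p.1.1) p.1.2 :=
    continuous_pathToI.comp ((hP.comp h1).prodMk h2)
  have hb0 : Continuous fun p : A ×ˢ B => pathToI (P 0) p.1.2 :=
    continuous_pathToI.comp (continuous_const.prodMk h2)
  have hm : Continuous fun p : A ×ˢ B => cplx (ψ p.1.1) := continuous_cplx.comp (hψ.comp h1)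
  exact (continuous_pairMatrix hb0 hb hm).matrix_det

/-- Let a path `ψ` from the identity expand the form of `P 0` into that of `P t`, for all `t > 0`.
If the Cayley transform of `ψ T` is `H J` with `H` diagonalizable, with the real eigenvalues
`h j`, then the argument of the determinant of the holomorphic part of `ψ` increases by
`∑ arg (1 + i h j)`.

The matrices `pairMatrix (pathToI (P 0) s) (pathToI (P t) s) (ψ t)` deform the holomorphic part
into a real matrix, and `cayleyMatrix (pathToI (P 0) s) τ (ψ T)` connects the end of this
deformation, at `t = T`, with the segment of the matrices `1 + i τ H`. -/
theorem exists_log_det_pairMatrix {T : ℝ} (hT : 0 < T) {P : ℝ → Matrix ι ι ℝ}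
    (hPc : ContinuousOn P (Icc 0 T)) (hPs : ∀ t ∈ Icc 0 T, (P t).IsSymm) (hP0 : (P 0).det ≠ 0)
    (hper : P 0 = P T) {ψ : ℝ → Matrix (ι ⊕ ι) (ι ⊕ ι) ℝ} (hψc : ContinuousOn ψ (Icc 0 T))
    (hψ0 : ψ 0 = 1) (hψ : ∀ t ∈ Ioc 0 T, IsExpanding (P 0) (P t) (ψ t))
    {H : Matrix (ι ⊕ ι) (ι ⊕ ι) ℝ} (hH : ψ T + 1 = H * J ι ℝ * (ψ T - 1))
    {U V : Matrix (ι ⊕ ι) (ι ⊕ ι) ℂ} {h : ι ⊕ ι → ℝ} (hVU : V * U = 1)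
    (hUV : cplx H = U * diagonal (fun j => (h j : ℂ)) * V) :
    ∃ g : ℝ → ℂ, ContinuousOn g (Icc 0 T) ∧
      (∀ t ∈ Icc 0 T, Complex.exp (g t) =
        (pairMatrix (Complex.I • 1) (Complex.I • 1) (cplx (ψ t))).det) ∧
      (g T - g 0).im = ∑ j, (1 + Complex.I * h j).arg := by
  have hT0 : (0 : ℝ) ∈ Icc 0 T := left_mem_Icc.2 hT.le
  have hTT : T ∈ Icc 0 T := right_mem_Icc.2 hT.le
  have h10 : (0 : ℝ) ∈ Icc (0 : ℝ) 1 := left_mem_Icc.2 zero_le_one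
  have h11 : (1 : ℝ) ∈ Icc (0 : ℝ) 1 := right_mem_Icc.2 zero_le_one
  have hexp : IsExpanding (P 0) (P 0) (ψ T) := by
    have := hψ T ⟨hT, le_rfl⟩
    rwa [← hper] at this
  -- the logarithm of the first family
  let F : ℝ × ℝ → ℂ := fun p =>
    (pairMatrix (pathToI (P 0) p.2) (pathToI (P p.1) p.2) (cplx (ψ p.1))).det
  have hF0 : ∀ p ∈ Icc 0 T ×ˢ Icc (0 : ℝ) 1, F p ≠ 0 := by
    rintro ⟨t, s⟩ ⟨ht, hs⟩
    rcases ht.1.eq_or_lt with h0 | h0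
    · obtain rfl : t = 0 := h0.symm
      simp only [F, hψ0, cplx_one]
      exact det_pairMatrix_one_ne_zero (hPs 0 hT0) hP0 s
    · exact (hψ t ⟨h0, ht.2⟩).det_pairMatrix_ne_zero (hPs 0 hT0) (hPs t ht) hs.1
  have hFc : ContinuousOn F (Icc 0 T ×ˢ Icc 0 1) := continuousOn_det_pairMatrix hPc hψc
  obtain ⟨g, hgc, hg⟩ := exists_continuousOn_log_prod hT.le zero_le_one hFc hF0
  have hgt : ∀ s ∈ Icc (0 : ℝ) 1, ContinuousOn (fun t => g (t, s)) (Icc 0 T) := fun s hs =>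
    hgc.comp (continuousOn_id.prodMk continuousOn_const) fun t ht => ⟨ht, hs⟩
  have hgs : ∀ t ∈ Icc 0 T, ContinuousOn (fun s => g (t, s)) (Icc 0 1) := fun t ht =>
    hgc.comp (continuousOn_const.prodMk continuousOn_id) fun s hs => ⟨ht, hs⟩
  -- the logarithm of the second family
  let E : ℝ × ℝ → ℂ := fun p => (cayleyMatrix (pathToI (P 0) p.1) p.2 (cplx (ψ T))).det
  have hE0 : ∀ p ∈ Icc (0 : ℝ) 1 ×ˢ Icc (0 : ℝ) 1, E p ≠ 0 := by
    rintro ⟨s, τ⟩ ⟨hs, hτ⟩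
    exact hexp.det_cayleyMatrix_ne_zero (hPs 0 hT0) hP0 hs.1 hτ.1
  have hEc : ContinuousOn E (Icc 0 1 ×ˢ Icc 0 1) := by
    have hb : Continuous fun p : ℝ × ℝ => pathToI (P 0) p.1 :=
      continuous_pathToI.comp (continuous_const.prodMk continuous_fst)
    exact (continuous_cayleyMatrix hb continuous_snd continuous_const).matrix_det.continuousOn
  obtain ⟨e, hec, he⟩ := exists_continuousOn_log_prod zero_le_one zero_le_one hEc hE0
  have hes : ∀ τ ∈ Icc (0 : ℝ) 1, ContinuousOn (fun s => e (s, τ)) (Icc 0 1) := fun s hs =>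
    hec.comp (continuousOn_id.prodMk continuousOn_const) fun t ht => ⟨ht, hs⟩
  have heτ : ∀ s ∈ Icc (0 : ℝ) 1, ContinuousOn (fun τ => e (s, τ)) (Icc 0 1) := fun t ht =>
    hec.comp (continuousOn_const.prodMk continuousOn_id) fun s hs => ⟨ht, hs⟩
  -- the edges on which the determinants are real
  have hreal₁ : (g (T, 1)).im = (g (0, 1)).im :=
    im_eq_of_exp_im_eq_zero hT.le (hgt 1 h11) fun t ht => by
      rw [hg _ ⟨ht, h11⟩]
      simp only [F, pathToI_one]
      exact im_det_pairMatrix_cplx _ _ _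
  have hreal₂ : (e (1, 1)).im = (e (1, 0)).im :=
    im_eq_of_exp_im_eq_zero zero_le_one (heτ 1 h11) fun τ hτ => by
      rw [he _ ⟨h11, hτ⟩]
      have : cayleyMatrix (cplx (P 0)) τ (cplx (ψ T)) =
          cplx (fromBlocks 1 (P 0) (-1) (P 0) * (ψ T - 1) +
            τ • (fromBlocks 1 (P 0) 1 (-P 0) * (ψ T + 1))) := by
        simp [cayleyMatrix, cplx_add, cplx_sub, cplx_mul, cplx_smul, cplx_fromBlocks, cplx_neg]
      simp only [E, pathToI_one]
      rw [this, det_cplx, Complex.ofReal_im]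
  -- the edges shared by the two families
  have hcommon₁ : e (1, 1) - e (0, 1) = g (T, 1) - g (T, 0) :=
    sub_eq_sub_of_exp_eq_mul zero_le_one (hes 1 h11) (hgs T hTT)
      (w := 2 ^ Fintype.card (ι ⊕ ι)) fun s hs => by
      rw [he _ ⟨hs, h11⟩, hg _ ⟨hTT, hs⟩]
      simp only [E, F, cayleyMatrix_one, det_smul, ← hper]
  have hcommon₂ : e (1, 0) - e (0, 0) = g (0, 1) - g (0, 0) :=
    sub_eq_sub_of_exp_eq_mul zero_le_one (hes 0 h10) (hgs 0 hT0)
      (w := (fromBlocks 1 0 0 (-1) : Matrix (ι ⊕ ι) (ι ⊕ ι) ℂ).det * (cplx (ψ T) - 1).det)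
      fun s hs => by
      rw [he _ ⟨hs, h10⟩, hg _ ⟨hT0, hs⟩]
      simp only [E, F, cayleyMatrix_zero, det_mul, hψ0, cplx_one]
      ring
  -- the edge on which the determinant is that of `1 + i τ H`
  have hlast : e (0, 1) - e (0, 0) = ∑ j, Complex.log (1 + Complex.I * h j) := by
    have hre : ∀ (τ : ℝ) j, 0 < (1 + τ * Complex.I * h j : ℂ).re := by simp
    have := sub_eq_sub_of_exp_eq_mul zero_le_one (heτ 0 h10)
      (h := fun τ => ∑ j, Complex.log (1 + τ * Complex.I * h j))
      (w := (pairMatrix (Complex.I • 1) (Complex.I • 1) (1 : Matrix (ι ⊕ ι) (ι ⊕ ι) ℂ)).det *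
        (-Complex.I • cplx (J ι ℝ)).det * (cplx (ψ T - 1)).det)
      (continuousOn_finsetSum _ fun j _ => by
        refine ContinuousOn.clog (by fun_prop) fun τ _ => Or.inl (hre τ j)) fun τ hτ => by
      rw [he _ ⟨h10, hτ⟩]
      simp only [E, pathToI_zero]
      rw [cayleyMatrix_I_eq hH, det_mul, det_mul, det_mul,
        det_one_add_smul_of_diagonalization hVU hUV, Complex.exp_sum,
        Finset.prod_congr rfl fun j _ => Complex.exp_log (x := 1 + τ * Complex.I * h j)
          fun hc => (hre τ j).ne' (by rw [hc, Complex.zero_re])]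
      ring
    simpa using this
  refine ⟨fun t => g (t, 0), hgt 0 h10, fun t ht => ?_, ?_⟩
  · rw [hg _ ⟨ht, h10⟩]
    simp only [F, pathToI_zero]
  · have h1 := congrArg Complex.im hcommon₁
    have h2 := congrArg Complex.im hcommon₂
    have h3 := congrArg Complex.im hlast
    simp only [Complex.sub_im, Complex.im_sum, Complex.log_im] at h1 h2 h3 ⊢
    linarith

end Increment

/-! ### Frames of Lagrangian subspaces -/

section Frame

variable {κ μ : Type*} [Fintype μ] [DecidableEq μ]

theorem mem_range_toEuclideanLin {F : Matrix κ μ ℝ} {z : EuclideanSpace ℝ κ} :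
    z ∈ LinearMap.range (toEuclideanLin F) ↔ ∃ w : μ → ℝ, F *ᵥ w = z.ofLp := by
  constructor
  · rintro ⟨w, rfl⟩
    exact ⟨w.ofLp, rfl⟩
  · rintro ⟨w, hw⟩
    exact ⟨WithLp.toLp 2 w, by rw [toLpLin_apply]; exact congrArg (WithLp.toLp 2) hw⟩

variable [Fintype κ] [DecidableEq κ]

/-- The orthogonal projection onto the span of the columns of `F` is `F (Fᵀ F)⁻¹ Fᵀ`. -/
theorem starProjection_range_toEuclideanLin (F : Matrix κ μ ℝ) (hF : IsUnit (Fᵀ * F).det) :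
    (LinearMap.range (toEuclideanLin F)).starProjection =
      toEuclideanCLM (𝕜 := ℝ) (F * (Fᵀ * F)⁻¹ * Fᵀ) := by
  ext1 z
  refine Submodule.eq_starProjection_of_mem_of_inner_eq_zero ?_ ?_
  · rw [mem_range_toEuclideanLin]
    exact ⟨((Fᵀ * F)⁻¹ * Fᵀ) *ᵥ z.ofLp, by
      rw [ofLp_toEuclideanCLM, mulVec_mulVec, Matrix.mul_assoc]⟩
  · rintro v ⟨w, rfl⟩
    rw [EuclideanSpace.inner_eq_star_dotProduct, toLpLin_apply]
    simp only [WithLp.ofLp_sub, ofLp_toEuclideanCLM, star_trivial]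
    rw [dotProduct_comm, dotProduct_mulVec, ← mulVec_transpose, mulVec_sub, mulVec_mulVec,
      ← Matrix.mul_assoc, ← Matrix.mul_assoc, mul_nonsing_inv _ hF, Matrix.one_mul, sub_self,
      zero_dotProduct]

end Frame

section LagrangianFrame

variable {n : ℕ}

theorem dblJ_transpose : (dblJ n)ᵀ = -dblJ n := by
  simp [dblJ, fromBlocks_transpose, fromBlocks_neg, J_transpose]

theorem dblJ_mul_dblJ : dblJ n * dblJ n = -1 := by
  simp [dblJ, fromBlocks_multiply, J_squared, ← fromBlocks_one, fromBlocks_neg]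

/-- `F` is a frame of a Lagrangian subspace: its columns are independent and isotropic. -/
structure IsLagrangianFrame (F : Matrix (Ph n ⊕ Ph n) (Ph n) ℝ) : Prop where
  isUnit_det : IsUnit (Fᵀ * F).det
  isotropic : Fᵀ * dblJ n * F = 0

theorem reflMatrix_range {F : Matrix (Ph n ⊕ Ph n) (Ph n) ℝ} (hF : IsUnit (Fᵀ * F).det) :
    reflMatrix (LinearMap.range (toEuclideanLin F)) = 2 • (F * (Fᵀ * F)⁻¹ * Fᵀ) - 1 := by
  rw [reflMatrix, starProjection_range_toEuclideanLin F hF, coe_toEuclideanCLM_eq_toEuclideanLin,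
    map_sub, map_nsmul, LinearEquiv.symm_apply_apply]
  congr 1
  rw [LinearEquiv.symm_apply_eq]
  ext1 z
  simp

namespace IsLagrangianFrame

variable {F : Matrix (Ph n ⊕ Ph n) (Ph n) ℝ}

theorem reflMatrix_mul (hF : IsLagrangianFrame F) :
    reflMatrix (LinearMap.range (toEuclideanLin F)) * F = F := by
  rw [reflMatrix_range hF.isUnit_det, Matrix.sub_mul, Matrix.smul_mul, Matrix.mul_assoc,
    Matrix.mul_assoc, nonsing_inv_mul _ hF.isUnit_det]
  simp [two_smul]

theorem reflMatrix_mul_dblJ (hF : IsLagrangianFrame F) :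
    reflMatrix (LinearMap.range (toEuclideanLin F)) * (dblJ n * F) = -(dblJ n * F) := by
  rw [reflMatrix_range hF.isUnit_det, Matrix.sub_mul, Matrix.smul_mul, Matrix.mul_assoc _ Fᵀ,
    ← Matrix.mul_assoc Fᵀ, hF.isotropic]
  simp

/-- The columns of `F` and of `𝒥 F` together form a basis, so the span of `F` is its own
symplectic orthogonal. -/
theorem isLagrangian_range (hF : IsLagrangianFrame F) :
    IsLagrangian (LinearMap.range (toEuclideanLin F)) := by
  have hform : ∀ (z : DblSpace n) (w : Ph n → ℝ),
      dblForm z (toEuclideanLin F (WithLp.toLp 2 w)) = ((Fᵀ * dblJ n) *ᵥ z.ofLp) ⬝ᵥ w := by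
    intro z w
    rw [dblForm, EuclideanSpace.inner_eq_star_dotProduct, toLpLin_apply,
      toLpLin_apply, star_trivial, dotProduct_comm, dotProduct_mulVec, ← mulVec_transpose,
      mulVec_mulVec]
  intro z
  constructor
  · intro hz w hw
    obtain ⟨v, rfl⟩ := hw
    obtain ⟨u, hu⟩ := mem_range_toEuclideanLin.1 hz
    rw [← WithLp.toLp_ofLp (p := 2) v, hform, ← hu, mulVec_mulVec, hF.isotropic]
    simp
  · intro hz
    have h0 : (Fᵀ * dblJ n) *ᵥ z.ofLp = 0 := by
      refine dotProduct_eq_zero _ fun w => ?_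
      rw [← hform]
      exact hz _ ⟨_, rfl⟩
    set W := fromCols F (dblJ n * F) with hW
    have hiso : Fᵀ * (dblJ n * F) = 0 := by rw [← Matrix.mul_assoc, hF.isotropic]
    have hWW : Wᵀ * W = fromBlocks (Fᵀ * F) 0 0 (Fᵀ * F) := by
      rw [hW, transpose_fromCols, fromRows_mul_fromCols, transpose_mul, dblJ_transpose, hiso]
      congr 1
      · rw [Matrix.mul_assoc, Matrix.neg_mul, Matrix.mul_neg, hiso, neg_zero]
      · rw [Matrix.mul_assoc, ← Matrix.mul_assoc (-dblJ n), Matrix.neg_mul, dblJ_mul_dblJ, neg_neg,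
          Matrix.one_mul]
    have hdet : IsUnit W.det := by
      have : IsUnit (Wᵀ * W).det := by
        rw [hWW, det_fromBlocks_zero₂₁]
        exact hF.isUnit_det.mul hF.isUnit_det
      rw [det_mul] at this
      exact isUnit_of_mul_isUnit_right this
    set c := W⁻¹ *ᵥ z.ofLp with hc
    have hz' : W *ᵥ c = z.ofLp := by
      rw [hc, mulVec_mulVec, mul_nonsing_inv _ hdet, one_mulVec]
    have hz2 : F *ᵥ (c ∘ Sum.inl) + (dblJ n * F) *ᵥ (c ∘ Sum.inr) = z.ofLp := by
      rw [← hz', hW, fromCols_mulVec]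
    have h1 : (Fᵀ * F) *ᵥ (c ∘ Sum.inr) = 0 := by
      rw [← hz2, mulVec_add, mulVec_mulVec, mulVec_mulVec, hF.isotropic, zero_mulVec, zero_add,
        Matrix.mul_assoc, ← Matrix.mul_assoc (dblJ n), dblJ_mul_dblJ] at h0
      simpa [neg_mulVec] using h0
    have h2 : c ∘ Sum.inr = 0 := by
      have := congrArg ((Fᵀ * F)⁻¹ *ᵥ ·) h1
      simpa [mulVec_mulVec, nonsing_inv_mul _ hF.isUnit_det] using this
    rw [mem_range_toEuclideanLin]
    exact ⟨c ∘ Sum.inl, by rw [← hz2, h2, mulVec_zero, add_zero]⟩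

end IsLagrangianFrame

/-! ### Rotated graphs -/

/-- The matrix `cos ε - sin ε 𝒥` of `e^{-ε𝒥}`. -/
def rotMatrix (n : ℕ) (ε : ℝ) : Matrix (Ph n ⊕ Ph n) (Ph n ⊕ Ph n) ℝ :=
  Real.cos ε • 1 - Real.sin ε • dblJ n

theorem rotMatrix_transpose_mul (ε : ℝ) : (rotMatrix n ε)ᵀ * rotMatrix n ε = 1 := by
  have h := Real.cos_sq_add_sin_sq ε
  simp only [rotMatrix, transpose_sub, transpose_smul, transpose_one, dblJ_transpose, sub_mul,
    mul_sub, smul_mul_assoc, mul_smul_comm, one_mul, mul_one, smul_neg, neg_mul, dblJ_mul_dblJ]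
  linear_combination (norm := module) h • (1 : Matrix (Ph n ⊕ Ph n) (Ph n ⊕ Ph n) ℝ)

theorem rotMatrix_comm (ε : ℝ) : dblJ n * rotMatrix n ε = rotMatrix n ε * dblJ n := by
  simp [rotMatrix, mul_sub, sub_mul]

/-- The frame `e^{-ε𝒥} (1, M)` of the rotated graph of `M`. -/
def graphFrame (ε : ℝ) (M : Matrix (Ph n) (Ph n) ℝ) : Matrix (Ph n ⊕ Ph n) (Ph n) ℝ :=
  rotMatrix n ε * fromRows (1 : Matrix (Ph n) (Ph n) ℝ) M

theorem rotateBack_graphOf (ε : ℝ) (M : Matrix (Ph n) (Ph n) ℝ) :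
    rotateBack ε (graphOf M) = LinearMap.range (toEuclideanLin (graphFrame ε M)) := by
  rw [rotateBack, graphOf, ← LinearMap.range_comp, graphFrame, rotMatrix]
  congr 1
  exact (toLpLin_mul ..).symm

theorem graphFrame_transpose_mul (ε : ℝ) (M : Matrix (Ph n) (Ph n) ℝ) :
    (graphFrame ε M)ᵀ * graphFrame ε M = 1 + Mᵀ * M := by
  rw [graphFrame, transpose_mul, Matrix.mul_assoc, ← Matrix.mul_assoc _ (rotMatrix n ε),
    rotMatrix_transpose_mul, Matrix.one_mul, transpose_fromRows, fromCols_mul_fromRows]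
  simp

theorem isUnit_det_one_add_transpose_mul (M : Matrix (Ph n) (Ph n) ℝ) :
    IsUnit (1 + Mᵀ * M).det := by
  have h := PosDef.one.add_posSemidef (posSemidef_conjTranspose_mul_self M)
  simpa [conjTranspose_eq_transpose_of_trivial] using h.det_pos.ne'

theorem isLagrangianFrame_graphFrame (ε : ℝ) {M : Matrix (Ph n) (Ph n) ℝ}
    (hM : Mᵀ * J (Fin n) ℝ * M = J (Fin n) ℝ) : IsLagrangianFrame (graphFrame ε M) where
  isUnit_det := by
    rw [graphFrame_transpose_mul]
    exact isUnit_det_one_add_transpose_mul M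
  isotropic := by
    rw [graphFrame, transpose_mul, Matrix.mul_assoc, Matrix.mul_assoc, ← Matrix.mul_assoc (dblJ n),
      rotMatrix_comm, Matrix.mul_assoc (rotMatrix n ε), ← Matrix.mul_assoc _ (rotMatrix n ε),
      rotMatrix_transpose_mul, Matrix.one_mul, dblJ, transpose_fromRows, fromBlocks_mul_fromRows,
      fromCols_mul_fromRows]
    simp [← Matrix.mul_assoc, hM]

theorem graphFrame_zero (M : Matrix (Ph n) (Ph n) ℝ) : graphFrame 0 M = fromRows 1 M := by
  simp [graphFrame, rotMatrix]

/-- A continuous path of symplectic matrices gives a continuous path of rotated graphs. -/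
theorem isLagrangianPath_rotateBack_graphOf {ψ : ℝ → Matrix (Ph n) (Ph n) ℝ} {a b : ℝ}
    (hψ : ContinuousOn ψ (Icc a b))
    (hs : ∀ t ∈ Icc a b, (ψ t)ᵀ * J (Fin n) ℝ * ψ t = J (Fin n) ℝ) (ε : ℝ) :
    IsLagrangianPath (fun t => rotateBack ε (graphOf (ψ t))) a b := by
  refine ⟨fun t ht => ?_, ?_⟩
  · simp only [rotateBack_graphOf]
    exact (isLagrangianFrame_graphFrame ε (hs t ht)).isLagrangian_range
  · have h1 : ∀ t, (rotateBack ε (graphOf (ψ t))).starProjection =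
        toEuclideanCLM (𝕜 := ℝ)
          (graphFrame ε (ψ t) * (1 + (ψ t)ᵀ * ψ t)⁻¹ * (graphFrame ε (ψ t))ᵀ) := by
      intro t
      have hu : IsUnit ((graphFrame ε (ψ t))ᵀ * graphFrame ε (ψ t)).det := by
        rw [graphFrame_transpose_mul]
        exact isUnit_det_one_add_transpose_mul _
      rw [← graphFrame_transpose_mul ε, ← starProjection_range_toEuclideanLin _ hu]
      simp only [rotateBack_graphOf]
    simp only [h1]
    have hcont : Continuous (toEuclideanCLM (𝕜 := ℝ) (n := Ph n ⊕ Ph n)) :=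
      LinearMap.continuous_of_finiteDimensional
        (toEuclideanCLM (𝕜 := ℝ) (n := Ph n ⊕ Ph n)).toAlgEquiv.toLinearMap
    refine hcont.comp_continuousOn ?_
    rw [continuousOn_iff_continuous_domRestrict] at *
    have hF : Continuous fun t : Icc a b => graphFrame ε (ψ t) :=
      continuous_const.matrix_mul (continuous_pi fun i => Sum.casesOn i
        (fun i => continuous_const) fun i => (continuous_apply i).comp hψ)
    have hG : Continuous fun t : Icc a b => 1 + (ψ t)ᵀ * ψ t :=
      continuous_const.add (hψ.matrix_transpose.matrix_mul hψ)
    have hI : Continuous fun t : Icc a b => (1 + (ψ t)ᵀ * ψ t)⁻¹ := by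
      simp only [inv_def, Ring.inverse_eq_inv']
      exact (hG.matrix_det.inv₀ fun t => (isUnit_det_one_add_transpose_mul _).ne_zero).smul
        hG.matrix_adjugate
    exact (hF.matrix_mul hI).matrix_mul hF.matrix_transpose

end LagrangianFrame

/-! ### The Souriau matrix of a rotated graph -/

section ArgSum

variable {κ μ : Type*} [Fintype κ] [DecidableEq κ] [Fintype μ] [DecidableEq μ]

theorem argSum_fromBlocks_one (A : Matrix κ κ ℂ) :
    argSum (fromBlocks A 0 0 (1 : Matrix μ μ ℂ)) = argSum A := by
  rw [argSum, argSum, charpoly_fromBlocks_zero₁₂, charpoly_one, ← Polynomial.C_1,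
    Polynomial.roots_mul
      (mul_ne_zero A.charpoly_monic.ne_zero (pow_ne_zero _ (Polynomial.X_sub_C_ne_zero 1))),
    Polynomial.roots_pow, Polynomial.roots_X_sub_C]
  simp [Multiset.map_nsmul, Multiset.sum_nsmul]

theorem argSum_conj {A U V : Matrix κ κ ℂ} (hVU : V * U = 1) :
    argSum (U * A * V) = argSum A := by
  rw [argSum, argSum, charpoly_mul_comm, ← mul_assoc, hVU, one_mul]

theorem argSum_diagonal (d : κ → ℂ) : argSum (diagonal d) = ∑ j, (d j).arg := by
  rw [argSum, charpoly_diagonal, Polynomial.roots_prod _ _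
    (Finset.prod_ne_zero_iff.2 fun _ _ => Polynomial.X_sub_C_ne_zero _)]
  simp

end ArgSum

section HolomorphicPart

variable {ι : Type*} [DecidableEq ι]

/-- The projection `(1 - i J) / 2` onto the `i`-eigenspace of `J`. -/
def projI (ι : Type*) [DecidableEq ι] : Matrix (ι ⊕ ι) (ι ⊕ ι) ℂ :=
  (1 / 2 : ℂ) • (1 - Complex.I • cplx (J ι ℝ))

/-- The projection `(1 + i J) / 2` onto the `(-i)`-eigenspace of `J`. -/
def projNegI (ι : Type*) [DecidableEq ι] : Matrix (ι ⊕ ι) (ι ⊕ ι) ℂ :=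
  (1 / 2 : ℂ) • (1 + Complex.I • cplx (J ι ℝ))

theorem projI_add_projNegI : projI ι + projNegI ι = 1 := by
  rw [projI, projNegI]; module

variable [Fintype ι]

/-- The matrix `(1 + i J) / 2 + (1 - i J) / 2 M`, whose determinant is that of the holomorphic
part of `M`. -/
def holoPart (M : Matrix (ι ⊕ ι) (ι ⊕ ι) ℝ) : Matrix (ι ⊕ ι) (ι ⊕ ι) ℂ :=
  projNegI ι + projI ι * cplx M

/-- The complex conjugate of `holoPart M`. -/
def antiholoPart (M : Matrix (ι ⊕ ι) (ι ⊕ ι) ℝ) : Matrix (ι ⊕ ι) (ι ⊕ ι) ℂ :=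
  projI ι + projNegI ι * cplx M

theorem cplx_J_mul_cplx_J : cplx (J ι ℝ) * cplx (J ι ℝ) = -1 := by
  rw [← cplx_mul, J_squared, cplx_neg, cplx_one]

theorem projI_mul_J : projI ι * cplx (J ι ℝ) = Complex.I • projI ι := by
  simp only [projI, smul_mul_assoc, sub_mul, one_mul, cplx_J_mul_cplx_J]
  linear_combination (norm := module)
    (1 / 2 : ℂ) • Complex.I_mul_I • cplx (J ι ℝ)

theorem projI_mul_projI : projI ι * projI ι = projI ι := by
  nth_rw 2 [projI]
  rw [mul_smul_comm, mul_sub, mul_smul_comm, projI_mul_J, mul_one]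
  linear_combination (norm := module) -(1 / 2 : ℂ) • Complex.I_mul_I • projI ι

theorem projI_mul_projNegI : projI ι * projNegI ι = 0 := by
  rw [eq_sub_of_add_eq' projI_add_projNegI, mul_sub, projI_mul_projI, mul_one, sub_self]

theorem projNegI_mul_projI : projNegI ι * projI ι = 0 := by
  rw [eq_sub_of_add_eq' projI_add_projNegI, sub_mul, projI_mul_projI, one_mul, sub_self]

theorem projNegI_mul_projNegI : projNegI ι * projNegI ι = projNegI ι := by
  nth_rw 1 [eq_sub_of_add_eq' projI_add_projNegI]
  rw [sub_mul, one_mul, projI_mul_projNegI, sub_zero]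

theorem holoPart_one : holoPart (1 : Matrix (ι ⊕ ι) (ι ⊕ ι) ℝ) = 1 := by
  rw [holoPart, cplx_one, mul_one, add_comm, projI_add_projNegI]

theorem antiholoPart_one : antiholoPart (1 : Matrix (ι ⊕ ι) (ι ⊕ ι) ℝ) = 1 := by
  rw [antiholoPart, cplx_one, mul_one, projI_add_projNegI]

theorem det_antiholoPart (M : Matrix (ι ⊕ ι) (ι ⊕ ι) ℝ) :
    (antiholoPart M).det = starRingEnd ℂ (holoPart M).det := by
  have hc : ∀ N : Matrix (ι ⊕ ι) (ι ⊕ ι) ℝ, (cplx N).map (starRingEnd ℂ) = cplx N := fun N => by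
    ext; simp
  have hsm : ∀ (c : ℂ) (N : Matrix (ι ⊕ ι) (ι ⊕ ι) ℂ),
      (c • N).map (starRingEnd ℂ) = starRingEnd ℂ c • N.map (starRingEnd ℂ) := fun c N => by
    ext; simp
  have h1 : (projI ι).map (starRingEnd ℂ) = projNegI ι := by
    rw [projI, projNegI, hsm, Matrix.map_sub _ (map_sub _), hsm, hc, ← cplx_one, hc]
    simp [sub_neg_eq_add, map_ofNat]
  have h2 : (projNegI ι).map (starRingEnd ℂ) = projI ι := by
    rw [projI, projNegI, hsm, Matrix.map_add _ (map_add _), hsm, hc, ← cplx_one, hc]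
    simp [sub_eq_add_neg, map_ofNat]
  rw [RingHom.map_det, RingHom.mapMatrix_apply, holoPart, Matrix.map_add _ (map_add _),
    Matrix.map_mul, h1, h2, hc, antiholoPart]

theorem pairMatrix_I_eq (M : Matrix (ι ⊕ ι) (ι ⊕ ι) ℝ) :
    pairMatrix (Complex.I • 1) (Complex.I • 1) (cplx M) =
      pairMatrix (Complex.I • 1) (Complex.I • 1) 1 * holoPart M := by
  have e1 : pairMatrix (Complex.I • 1) (Complex.I • 1) 1 * projI ι =
      fromBlocks 1 (Complex.I • 1) 0 0 := by
    simp only [pairMatrix, projI, J, cplx_fromBlocks, ← fromBlocks_one, cplx_neg, cplx_one,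
      cplx_zero, fromBlocks_smul, sub_eq_add_neg, fromBlocks_neg, fromBlocks_add,
      fromBlocks_multiply]
    simp [← add_smul, smul_smul]
    refine ⟨?_, ?_, Or.inl ?_⟩
    · linear_combination (norm := module)
        (-(1 / 2 : ℂ)) • Complex.I_mul_I • (1 : Matrix ι ι ℂ)
    · congr 1
      ring
    · linear_combination (1 / 2 : ℂ) * Complex.I_mul_I
  have e2 : pairMatrix (Complex.I • 1) (Complex.I • 1) 1 * projNegI ι =
      fromBlocks 0 0 1 (-(Complex.I • 1)) := by
    rw [eq_sub_of_add_eq' projI_add_projNegI, mul_sub, e1, mul_one, pairMatrix, mul_one,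
      add_sub_cancel_left]
  rw [holoPart, mul_add, ← mul_assoc, e1, e2, pairMatrix, add_comm]

/-- With `M + 1 = H J (M - 1)` and `H` diagonalizable, the matrix `-N N̄⁻¹`, for `N = holoPart M`,
is similar to the diagonal matrix of the numbers `(1 + i h) / (1 - i h)`. -/
theorem neg_holoPart_eq_of_diagonalization {M H : Matrix (ι ⊕ ι) (ι ⊕ ι) ℝ}
    (hH : M + 1 = H * J ι ℝ * (M - 1)) {U V : Matrix (ι ⊕ ι) (ι ⊕ ι) ℂ} {h : ι ⊕ ι → ℝ}
    (hVU : V * U = 1) (hUV : cplx H = U * diagonal (fun j => (h j : ℂ)) * V) :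
    -holoPart M =
      U * diagonal (fun j => (1 + Complex.I * h j) / (1 - Complex.I * h j)) * V *
        antiholoPart M := by
  set X := cplx (J ι ℝ) * cplx (M - 1) with hX
  have h1 : cplx M + 1 = cplx H * X := by
    rw [hX, ← mul_assoc, ← cplx_mul, ← cplx_mul, ← hH, cplx_add, cplx_one]
  have h2 : X = cplx (J ι ℝ) * cplx M - cplx (J ι ℝ) := by
    rw [hX, cplx_sub, cplx_one, mul_sub, mul_one]
  have h3 : -holoPart M = (Complex.I / 2) • ((1 + Complex.I • cplx H) * X) := by
    rw [add_mul, one_mul, smul_mul_assoc, ← h1, h2, holoPart, projI, projNegI, smul_mul_assoc,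
      sub_mul, smul_mul_assoc, one_mul]
    linear_combination (norm := module) (-(1 / 2 : ℂ)) • Complex.I_mul_I • (cplx M + 1)
  have h4 : antiholoPart M = (Complex.I / 2) • ((1 - Complex.I • cplx H) * X) := by
    rw [sub_mul, one_mul, smul_mul_assoc, ← h1, h2, antiholoPart, projI, projNegI, smul_mul_assoc,
      add_mul, smul_mul_assoc, one_mul]
    linear_combination (norm := module) (1 / 2 : ℂ) • Complex.I_mul_I • (cplx M + 1)
  have hne : ∀ j, (1 - Complex.I * h j : ℂ) ≠ 0 := fun j hc => by
    have := congrArg Complex.re hc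
    simp at this
  clear_value X
  rw [h3, h4, mul_smul_comm, sub_eq_add_neg, ← neg_smul,
    one_add_smul_of_diagonalization hVU hUV, one_add_smul_of_diagonalization hVU hUV]
  simp only [← mul_assoc]
  rw [mul_assoc _ V U, hVU, mul_one, mul_assoc U (diagonal _) (diagonal _), diagonal_mul_diagonal]
  congr 5
  ext j
  rw [neg_mul, ← sub_eq_add_neg, div_mul_cancel₀ _ (hne j)]

end HolomorphicPart

section Souriau

variable {n : ℕ}

/-- The projection `(1 - i 𝒥) / 2` that enters the Souriau matrix. -/
def dblProj (n : ℕ) : Matrix (Ph n ⊕ Ph n) (Ph n ⊕ Ph n) ℂ :=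
  (1 / 2 : ℂ) • (1 - Complex.I • cplx (dblJ n))

theorem dblProj_eq_fromBlocks :
    dblProj n = fromBlocks (projNegI (Fin n)) 0 0 (projI (Fin n)) := by
  simp only [dblProj, dblJ, projI, projNegI, cplx_fromBlocks, cplx_neg, cplx_zero,
    ← fromBlocks_one, fromBlocks_smul, sub_eq_add_neg, fromBlocks_neg, fromBlocks_add]
  simp

theorem one_sub_dblProj_eq_fromBlocks :
    1 - dblProj n = fromBlocks (projI (Fin n)) 0 0 (projNegI (Fin n)) := by
  rw [dblProj_eq_fromBlocks, ← fromBlocks_one, sub_eq_add_neg, fromBlocks_neg, fromBlocks_add,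
    ← sub_eq_add_neg, ← sub_eq_add_neg, ← projI_add_projNegI]
  simp

theorem dblProj_mul_dblProj : dblProj n * dblProj n = dblProj n := by
  simp [dblProj_eq_fromBlocks, fromBlocks_multiply, projI_mul_projI, projNegI_mul_projNegI]

/-- The reflection in a Lagrangian subspace exchanges the two eigenspaces of `𝒥`. -/
theorem IsLagrangianFrame.refl_mul_dblProj {F : Matrix (Ph n ⊕ Ph n) (Ph n) ℝ}
    (hF : IsLagrangianFrame F) :
    cplx (reflMatrix (LinearMap.range (toEuclideanLin F))) * (dblProj n * cplx F) =
      (1 - dblProj n) * cplx F := by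
  have h1 : dblProj n * cplx F = (1 / 2 : ℂ) • (cplx F - Complex.I • cplx (dblJ n * F)) := by
    rw [dblProj, Matrix.smul_mul, Matrix.sub_mul, Matrix.smul_mul, Matrix.one_mul, cplx_mul]
  rw [Matrix.sub_mul, h1, Matrix.mul_smul, Matrix.mul_sub, Matrix.mul_smul, ← cplx_mul, ← cplx_mul,
    hF.reflMatrix_mul, hF.reflMatrix_mul_dblJ, cplx_neg, Matrix.one_mul]
  module

theorem IsLagrangianFrame.refl_mul_one_sub_dblProj {F : Matrix (Ph n ⊕ Ph n) (Ph n) ℝ}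
    (hF : IsLagrangianFrame F) :
    cplx (reflMatrix (LinearMap.range (toEuclideanLin F))) * ((1 - dblProj n) * cplx F) =
      dblProj n * cplx F := by
  rw [Matrix.sub_mul, Matrix.mul_sub, hF.refl_mul_dblProj, Matrix.one_mul, ← cplx_mul,
    hF.reflMatrix_mul, Matrix.sub_mul, Matrix.one_mul, sub_sub_cancel]

theorem dblProj_mul_rotMatrix (ε : ℝ) :
    dblProj n * cplx (rotMatrix n ε) = Complex.exp (-(ε * Complex.I)) • dblProj n := by
  have h1 : dblProj n * cplx (dblJ n) = Complex.I • dblProj n := by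
    have h2 : cplx (dblJ n) * cplx (dblJ n) = -1 := by
      rw [← cplx_mul, dblJ_mul_dblJ, cplx_neg, cplx_one]
    simp only [dblProj, smul_mul_assoc, sub_mul, one_mul, h2]
    linear_combination (norm := module)
      (1 / 2 : ℂ) • Complex.I_mul_I • cplx (dblJ n)
  rw [rotMatrix, cplx_sub, cplx_smul, cplx_smul, cplx_one, mul_sub, mul_smul_comm, mul_smul_comm,
    mul_one, h1, ← neg_mul, Complex.exp_mul_I, Complex.cos_neg, Complex.sin_neg,
    Complex.ofReal_cos, Complex.ofReal_sin]
  module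

theorem one_sub_dblProj_mul_rotMatrix (ε : ℝ) :
    (1 - dblProj n) * cplx (rotMatrix n ε) = Complex.exp (ε * Complex.I) • (1 - dblProj n) := by
  have h2 : cplx (dblJ n) * cplx (dblJ n) = -1 := by
    rw [← cplx_mul, dblJ_mul_dblJ, cplx_neg, cplx_one]
  have h1 : (1 - dblProj n) * cplx (dblJ n) = -Complex.I • (1 - dblProj n) := by
    simp only [dblProj, smul_mul_assoc, sub_mul, one_mul, h2]
    linear_combination (norm := module)
      (1 / 2 : ℂ) • Complex.I_mul_I • cplx (dblJ n)
  rw [rotMatrix, cplx_sub, cplx_smul, cplx_smul, cplx_one, mul_sub, mul_smul_comm, mul_smul_comm,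
    mul_one, h1, Complex.exp_mul_I, Complex.ofReal_cos, Complex.ofReal_sin]
  module

theorem cplx_fromRows (M : Matrix (Ph n) (Ph n) ℝ) :
    cplx (fromRows (1 : Matrix (Ph n) (Ph n) ℝ) M) = fromRows 1 (cplx M) := by
  ext (i | i) j
  · exact congrFun (congrFun cplx_one i) j
  · rfl

theorem dblProj_mul_graphFrame (ε : ℝ) (M : Matrix (Ph n) (Ph n) ℝ) :
    dblProj n * cplx (graphFrame ε M) = (dblProj n * cplx (graphFrame (n := n) 0 1)) *
      (Complex.exp (-(ε * Complex.I)) • holoPart M) := by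
  rw [graphFrame_zero, graphFrame, cplx_mul, ← Matrix.mul_assoc, dblProj_mul_rotMatrix,
    Matrix.smul_mul, Matrix.mul_smul, dblProj_eq_fromBlocks, cplx_fromRows, cplx_fromRows, cplx_one,
    fromBlocks_mul_fromRows, fromBlocks_mul_fromRows, fromRows_mul, holoPart]
  simp [mul_add, ← mul_assoc, projNegI_mul_projNegI, projNegI_mul_projI, projI_mul_projNegI,
    projI_mul_projI]

theorem one_sub_dblProj_mul_graphFrame (ε : ℝ) (M : Matrix (Ph n) (Ph n) ℝ) :
    (1 - dblProj n) * cplx (graphFrame ε M) = ((1 - dblProj n) * cplx (graphFrame (n := n) 0 1)) *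
      (Complex.exp (ε * Complex.I) • antiholoPart M) := by
  rw [graphFrame_zero, graphFrame, cplx_mul, ← Matrix.mul_assoc, one_sub_dblProj_mul_rotMatrix,
    Matrix.smul_mul, Matrix.mul_smul, one_sub_dblProj_eq_fromBlocks, cplx_fromRows, cplx_fromRows,
    cplx_one, fromBlocks_mul_fromRows, fromBlocks_mul_fromRows, fromRows_mul, antiholoPart]
  simp [mul_add, ← mul_assoc, projNegI_mul_projNegI, projNegI_mul_projI, projI_mul_projNegI,
    projI_mul_projI]

/-- The matrix with the block columns `p (1, 1)` and `(1 - p) (1, 1)`, for `p = dblProj`; these are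
bases of the `i`-eigenspace and of the `(-i)`-eigenspace of `𝒥`. -/
def souriauBasis (n : ℕ) : Matrix (Ph n ⊕ Ph n) (Ph n ⊕ Ph n) ℂ :=
  fromBlocks (projNegI (Fin n)) (projI (Fin n)) (projI (Fin n)) (projNegI (Fin n))

theorem souriauBasis_mul_self : souriauBasis n * souriauBasis n = 1 := by
  have h : projNegI (Fin n) + projI (Fin n) = 1 := by rw [add_comm, projI_add_projNegI]
  simp [souriauBasis, fromBlocks_multiply, projI_mul_projI, projNegI_mul_projNegI,
    projI_mul_projNegI, projNegI_mul_projI, projI_add_projNegI, h]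

theorem souriauBasis_eq_fromCols : souriauBasis n =
    fromCols (dblProj n * cplx (graphFrame (n := n) 0 1))
      ((1 - dblProj n) * cplx (graphFrame (n := n) 0 1)) := by
  rw [graphFrame_zero, cplx_fromRows, one_sub_dblProj_eq_fromBlocks, dblProj_eq_fromBlocks,
    fromBlocks_mul_fromRows, fromBlocks_mul_fromRows, souriauBasis, cplx_one]
  simp [fromCols_fromRows_eq_fromBlocks]

/-- In the basis `souriauBasis`, the Souriau matrix of the diagonal and the rotated graph of `M`
is `-e^{-2iε} N N̄⁻¹` on the `i`-eigenspace of `𝒥`, for `N = holoPart M`. -/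
theorem souriau_rotateBack_graphOf (ε : ℝ) {M : Matrix (Ph n) (Ph n) ℝ}
    (hM : Mᵀ * J (Fin n) ℝ * M = J (Fin n) ℝ) {A : Matrix (Ph n) (Ph n) ℂ}
    (hA : -holoPart M = A * antiholoPart M) (hN : IsUnit (antiholoPart M).det) :
    souriau (graphOf 1) (rotateBack ε (graphOf M)) =
      souriauBasis n * fromBlocks (Complex.exp (-(2 * ε * Complex.I)) • A) 0 0 1 *
        souriauBasis n := by
  have h0 : IsLagrangianFrame (graphFrame (n := n) 0 1) :=
    isLagrangianFrame_graphFrame 0 (by simp)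
  have h1 := isLagrangianFrame_graphFrame ε hM
  have hg : graphOf (n := n) 1 = LinearMap.range (toEuclideanLin (graphFrame (n := n) 0 1)) := by
    rw [graphFrame_zero]; rfl
  set R := cplx (reflMatrix (LinearMap.range (toEuclideanLin (graphFrame ε M)))) with hR
  set R₀ := cplx (reflMatrix (LinearMap.range (toEuclideanLin (graphFrame (n := n) 0 1)))) with hR₀
  set f := dblProj n * cplx (graphFrame (n := n) 0 1) with hf
  set f' := (1 - dblProj n) * cplx (graphFrame (n := n) 0 1) with hf'
  have hK : souriau (graphOf 1) (rotateBack ε (graphOf M)) =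
      (1 - dblProj n) - R * R₀ * dblProj n := by
    rw [rotateBack_graphOf, hg, hR, hR₀, ← cplx_mul]
    rfl
  have hpf : dblProj n * f = f := by rw [hf, ← Matrix.mul_assoc, dblProj_mul_dblProj]
  have hpf' : dblProj n * f' = 0 := by
    rw [hf', ← Matrix.mul_assoc, mul_sub, dblProj_mul_dblProj, mul_one, sub_self, Matrix.zero_mul]
  have hR₀f : R₀ * f = f' := h0.refl_mul_dblProj
  have he : Complex.exp (-(ε * Complex.I)) * Complex.exp (ε * Complex.I) = 1 := by
    rw [← Complex.exp_add]; simp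
  have he2 : Complex.exp (-(2 * ε * Complex.I)) =
      Complex.exp (-(ε * Complex.I)) * Complex.exp (-(ε * Complex.I)) := by
    rw [← Complex.exp_add]; ring_nf
  have hRf' : R * f' = -(f * (Complex.exp (-(2 * ε * Complex.I)) • A)) := by
    have h2 := h1.refl_mul_one_sub_dblProj
    rw [dblProj_mul_graphFrame, one_sub_dblProj_mul_graphFrame, ← hf, ← hf', ← hR,
      ← Matrix.mul_assoc, Matrix.mul_smul, Matrix.mul_smul] at h2
    have h3 : R * f' * antiholoPart M =
        -(f * (Complex.exp (-(2 * ε * Complex.I)) • A)) * antiholoPart M := by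
      have h4 := congrArg (Complex.exp (-(ε * Complex.I)) • ·) h2
      simp only [smul_smul, he, one_smul] at h4
      rw [h4, he2, Matrix.neg_mul, Matrix.mul_smul, Matrix.smul_mul, Matrix.mul_assoc f A, ← hA,
        Matrix.mul_neg, smul_neg, neg_neg]
    have h5 := congrArg (· * (antiholoPart M)⁻¹) h3
    simpa only [Matrix.mul_assoc, mul_nonsing_inv _ hN, Matrix.mul_one] using h5
  have hKV : souriau (graphOf 1) (rotateBack ε (graphOf M)) * souriauBasis n =
      souriauBasis n * fromBlocks (Complex.exp (-(2 * ε * Complex.I)) • A) 0 0 1 := by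
    rw [hK, souriauBasis_eq_fromCols, ← hf, ← hf', mul_fromCols, fromCols_mul_fromBlocks]
    congr 1
    · rw [Matrix.sub_mul, Matrix.sub_mul, Matrix.one_mul, hpf, sub_self, Matrix.mul_assoc, hpf,
        Matrix.mul_assoc, hR₀f, hRf', zero_sub, neg_neg, Matrix.mul_zero, add_zero]
    · rw [Matrix.sub_mul, Matrix.sub_mul, Matrix.one_mul, Matrix.mul_assoc, hpf', Matrix.mul_zero,
        Matrix.mul_zero, Matrix.mul_one, sub_zero, sub_zero, zero_add]
  rw [← hKV, mul_assoc, souriauBasis_mul_self, mul_one]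

theorem argSum_souriau (ε : ℝ) {M : Matrix (Ph n) (Ph n) ℝ}
    (hM : Mᵀ * J (Fin n) ℝ * M = J (Fin n) ℝ) {U V : Matrix (Ph n) (Ph n) ℂ} {d : Ph n → ℂ}
    (hVU : V * U = 1) (hA : -holoPart M = U * diagonal d * V * antiholoPart M)
    (hN : IsUnit (antiholoPart M).det) :
    argSum (souriau (graphOf 1) (rotateBack ε (graphOf M))) =
      ∑ j, (Complex.exp (-(2 * ε * Complex.I)) * d j).arg := by
  rw [souriau_rotateBack_graphOf ε hM hA hN, argSum_conj souriauBasis_mul_self,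
    argSum_fromBlocks_one, ← argSum_diagonal, ← argSum_conj (A := diagonal _) hVU]
  congr 1
  rw [← smul_mul_assoc, ← mul_smul_comm, ← diagonal_smul]
  rfl

theorem det_souriau (ε : ℝ) {M : Matrix (Ph n) (Ph n) ℝ}
    (hM : Mᵀ * J (Fin n) ℝ * M = J (Fin n) ℝ) (hN : (holoPart M).det ≠ 0) :
    (souriau (graphOf 1) (rotateBack ε (graphOf M))).det =
      Complex.exp (-(4 * n * ε * Complex.I)) *
        ((holoPart M).det / starRingEnd ℂ (holoPart M).det) := by
  have hN' : IsUnit (antiholoPart M).det := by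
    rw [det_antiholoPart, isUnit_iff_ne_zero]
    exact (map_ne_zero _).2 hN
  have hA : -holoPart M = (-holoPart M * (antiholoPart M)⁻¹) * antiholoPart M := by
    rw [mul_assoc, nonsing_inv_mul _ hN', mul_one]
  have h1 : (-holoPart M * (antiholoPart M)⁻¹).det =
      (holoPart M).det / starRingEnd ℂ (holoPart M).det := by
    rw [det_mul, det_neg, det_nonsing_inv, det_antiholoPart, Ring.inverse_eq_inv', div_eq_mul_inv]
    simp [← two_mul]
  have h2 : Complex.exp (-(2 * ε * Complex.I)) ^ Fintype.card (Ph n) =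
      Complex.exp (-(4 * n * ε * Complex.I)) := by
    rw [← Complex.exp_nat_mul]
    congr 1
    simp
    ring
  rw [souriau_rotateBack_graphOf ε hM hA hN', det_mul, det_mul, mul_right_comm, ← det_mul,
    souriauBasis_mul_self, det_one, one_mul, det_fromBlocks_zero₂₁, det_one, mul_one, det_smul,
    h1, h2]

end Souriau

/-! ### Linear differential equations -/

section ODE

variable {κ : Type*} [Fintype κ]

theorem exists_forall_abs_apply_le {B : ℝ → Matrix κ κ ℝ} {a b : ℝ}
    (hB : ∀ i j, ContinuousOn (fun t => B t i j) (Icc a b)) :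
    ∃ C : ℝ, 0 ≤ C ∧ ∀ t ∈ Icc a b, ∀ i j, |B t i j| ≤ C := by
  have h : ContinuousOn (fun t => (fun i j => B t i j : κ → κ → ℝ)) (Icc a b) :=
    continuousOn_pi.2 fun i => continuousOn_pi.2 fun j => hB i j
  obtain ⟨C, hC⟩ := isCompact_Icc.exists_bound_of_continuousOn h
  refine ⟨max C 0, le_max_right _ _, fun t ht i j => ?_⟩
  exact ((norm_le_pi_norm (B t i) j).trans (norm_le_pi_norm (fun i j => B t i j) i)).trans
    ((hC t ht).trans (le_max_left _ _))

theorem norm_mulVec_le_of_norm_le {B : Matrix κ κ ℝ} {C : ℝ} (hB : ∀ i j, ‖B i j‖ ≤ C)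
    (x : κ → ℝ) : ‖B *ᵥ x‖ ≤ (Fintype.card κ * C) * ‖x‖ := by
  rcases isEmpty_or_nonempty κ with h | h
  · simp [Subsingleton.elim x 0]
  have hC : 0 ≤ C := (norm_nonneg _).trans (hB h.some h.some)
  rw [pi_norm_le_iff_of_nonneg (by positivity)]
  intro i
  calc ‖(B *ᵥ x) i‖ ≤ ∑ j, ‖B i j * x j‖ := norm_sum_le _ _
    _ ≤ ∑ _j : κ, C * ‖x‖ := Finset.sum_le_sum fun j _ => by
        rw [norm_mul]
        exact mul_le_mul (hB i j) (norm_le_pi_norm x j) (norm_nonneg _) hC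
    _ = (Fintype.card κ * C) * ‖x‖ := by simp [mul_assoc]

/-- A linear differential equation with continuous coefficients has a solution on the whole
interval. The Picard-Lindelöf theorem is applied to the field `B (t) r (x)`, where `r` truncates
the coordinates at a level that, by Grönwall's inequality, no solution reaches. -/
theorem exists_hasDerivWithinAt_mulVec {T : ℝ} (hT : 0 ≤ T) {B : ℝ → Matrix κ κ ℝ}
    (hB : ∀ i j, ContinuousOn (fun t => B t i j) (Icc 0 T)) (x₀ : κ → ℝ) :
    ∃ α : ℝ → κ → ℝ, α 0 = x₀ ∧
      ∀ t ∈ Icc 0 T, HasDerivWithinAt α (B t *ᵥ α t) (Icc 0 T) t := by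
  obtain ⟨K, hK0, hK⟩ : ∃ K : ℝ, 0 ≤ K ∧ ∀ t ∈ Icc 0 T, ∀ x, ‖B t *ᵥ x‖ ≤ K * ‖x‖ := by
    obtain ⟨C, hC0, hC⟩ := exists_forall_abs_apply_le hB
    exact ⟨Fintype.card κ * C, by positivity, fun t ht x => norm_mulVec_le_of_norm_le (hC t ht) x⟩
  set R : ℝ := ‖x₀‖ * Real.exp (K * T) with hR
  have hR0 : 0 ≤ R := by positivity
  let r : (κ → ℝ) → κ → ℝ := fun x i => max (-R) (min R (x i))
  have hr1 : ∀ x y, ‖r x - r y‖ ≤ ‖x - y‖ := fun x y => by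
    rw [pi_norm_le_iff_of_nonneg (norm_nonneg _)]
    intro i
    have h1 : |r x i - r y i| ≤ |min R (x i) - min R (y i)| := by
      simpa [r] using abs_max_sub_max_le_max (-R) (min R (x i)) (-R) (min R (y i))
    have h2 : |min R (x i) - min R (y i)| ≤ |x i - y i| := by
      simpa using abs_min_sub_min_le_max R (x i) R (y i)
    exact (h1.trans h2).trans (norm_le_pi_norm (x - y) i)
  have hr2 : ∀ x, ‖r x‖ ≤ R := fun x => by
    rw [pi_norm_le_iff_of_nonneg hR0]
    intro i
    rw [Real.norm_eq_abs, abs_le]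
    exact ⟨le_max_left _ _, max_le (by linarith) (min_le_left _ _)⟩
  have hr3 : ∀ x, ‖r x‖ ≤ ‖x‖ := fun x => by
    have : r 0 = 0 := by ext i; simp [r, hR0]
    simpa [this] using hr1 x 0
  have hr4 : ∀ x, ‖x‖ ≤ R → r x = x := fun x hx => by
    ext i
    have := abs_le.1 ((norm_le_pi_norm x i).trans hx)
    simp [r, this.1, this.2]
  have hPL : IsPicardLindelof (fun t x => B t *ᵥ r x) (⟨0, left_mem_Icc.2 hT⟩ : Icc 0 T) x₀
      ⟨K * R * T, by positivity⟩ 0 ⟨K * R, by positivity⟩ ⟨K, hK0⟩ := by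
    refine ⟨fun t ht => LipschitzWith.lipschitzOnWith ?_, fun x _ => ?_, fun t ht x _ => ?_, ?_⟩
    · refine LipschitzWith.of_dist_le_mul fun x y => ?_
      rw [dist_eq_norm, dist_eq_norm, ← mulVec_sub]
      exact (hK t ht _).trans (mul_le_mul_of_nonneg_left (hr1 x y) hK0)
    · exact continuousOn_pi.2 fun i => continuousOn_finsetSum _ fun j _ =>
        (hB i j).mul continuousOn_const
    · exact (hK t ht _).trans (mul_le_mul_of_nonneg_left (hr2 x) hK0)
    · simp only [sub_zero, hT, sup_of_le_left, NNReal.coe_zero]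
      exact le_refl (K * R * T)
  obtain ⟨α, h0, hα⟩ := hPL.exists_eq_forall_mem_Icc_hasDerivWithinAt₀
  have hα0 : α 0 = x₀ := h0
  have hbound : ∀ t ∈ Icc 0 T, ‖α t‖ ≤ R := by
    intro t ht
    have h1 := norm_le_gronwallBound_of_norm_deriv_right_le (δ := ‖x₀‖) (K := K) (ε := 0)
      (fun t ht => (hα t ht).continuousWithinAt)
      (fun t ht => (hα t (Ico_subset_Icc_self ht)).mono_of_mem_nhdsWithin
        (Icc_mem_nhdsGE_of_mem ht)) (by rw [hα0])
      (fun t ht => by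
        rw [add_zero]
        exact (hK t (Ico_subset_Icc_self ht) _).trans
          (mul_le_mul_of_nonneg_left (hr3 _) hK0)) t ht
    rw [gronwallBound_ε0, sub_zero] at h1
    refine h1.trans ?_
    rw [hR]
    gcongr
    exact ht.2
  refine ⟨α, hα0, fun t ht => ?_⟩
  have := hα t ht
  rwa [hr4 _ (hbound t ht)] at this

theorem hasDerivWithinAt_dotProduct {u v : ℝ → κ → ℝ} {u' v' : κ → ℝ} {s : Set ℝ} {t : ℝ}
    (hu : ∀ i, HasDerivWithinAt (fun r => u r i) (u' i) s t)
    (hv : ∀ i, HasDerivWithinAt (fun r => v r i) (v' i) s t) :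
    HasDerivWithinAt (fun r => u r ⬝ᵥ v r) (u' ⬝ᵥ v t + u t ⬝ᵥ v') s t := by
  rw [dotProduct, dotProduct, ← Finset.sum_add_distrib]
  exact HasDerivWithinAt.fun_sum fun i _ => (hu i).mul (hv i)

theorem hasDerivWithinAt_mulVec {m : Type*} {M : ℝ → Matrix m κ ℝ} {v : ℝ → κ → ℝ}
    {M' : Matrix m κ ℝ} {v' : κ → ℝ} {s : Set ℝ} {t : ℝ}
    (hM : ∀ i j, HasDerivWithinAt (fun r => M r i j) (M' i j) s t)
    (hv : ∀ i, HasDerivWithinAt (fun r => v r i) (v' i) s t) (i : m) :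
    HasDerivWithinAt (fun r => (M r *ᵥ v r) i) ((M' *ᵥ v t + M t *ᵥ v') i) s t :=
  hasDerivWithinAt_dotProduct (hM i) hv

end ODE

/-! ### The fundamental solution -/

section Fundamental

variable {n : ℕ} {P : ℝ → Matrix (Fin n) (Fin n) ℝ} {T : ℝ}

theorem continuousOn_inv_apply (hP : ContinuousOn P (Icc 0 T))
    (hdet : ∀ t ∈ Icc 0 T, (P t).det ≠ 0) (i j : Fin n) :
    ContinuousOn (fun t => (P t)⁻¹ i j) (Icc 0 T) := by
  rw [continuousOn_iff_continuous_domRestrict] at *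
  have h1 : Continuous fun t : Icc 0 T => (P t)⁻¹ := by
    simp only [inv_def, Ring.inverse_eq_inv']
    exact (hP.matrix_det.inv₀ fun t => hdet t t.2).smul hP.matrix_adjugate
  exact h1.matrix_elem i j

theorem J_mul_hamMatrix (s t : ℝ) :
    J (Fin n) ℝ * hamMatrix P s t = fromBlocks 0 (s • P t) (P t)⁻¹ 0 := by
  simp [J, hamMatrix, fromBlocks_multiply]

theorem exists_isFundamentalSolution (hT : 0 < T) (hP : ContinuousOn P (Icc 0 T))
    (hdet : ∀ t ∈ Icc 0 T, (P t).det ≠ 0) (s : ℝ) :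
    ∃ ψ : ℝ → Matrix (Ph n) (Ph n) ℝ, IsFundamentalSolution P s T ψ := by
  have hB : ∀ i j, ContinuousOn (fun t => (J (Fin n) ℝ * hamMatrix P s t) i j) (Icc 0 T) := by
    simp only [J_mul_hamMatrix]
    rintro (i | i) (j | j)
    · exact continuousOn_const
    · exact continuousOn_const.mul (((continuous_apply_apply i j).comp_continuousOn hP))
    · exact continuousOn_inv_apply hP hdet i j
    · exact continuousOn_const
  choose α hα0 hα using fun j : Ph n =>
    exists_hasDerivWithinAt_mulVec hT.le hB ((1 : Matrix (Ph n) (Ph n) ℝ).col j)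
  refine ⟨fun t => of fun i j => α j t i, ?_, fun t ht i j => ?_⟩
  · ext i j
    simp [hα0]
  · exact (hasDerivWithinAt_pi.1 (hα j t ht)) i

variable {s : ℝ} {ψ : ℝ → Matrix (Ph n) (Ph n) ℝ}

theorem IsFundamentalSolution.continuousOn (hψ : IsFundamentalSolution P s T ψ) :
    ContinuousOn ψ (Icc 0 T) :=
  continuousOn_pi.2 fun i => continuousOn_pi.2 fun j t ht =>
    (hψ.2 t ht i j).continuousWithinAt

theorem hamMatrix_isSymm {t : ℝ} (hP : (P t).IsSymm) : (hamMatrix P s t).IsSymm := by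
  rw [hamMatrix, IsSymm, fromBlocks_transpose, transpose_nonsing_inv, hP.eq, transpose_neg,
    transpose_smul, hP.eq, transpose_zero]

theorem IsFundamentalSolution.transpose_mul_J_mul (hψ : IsFundamentalSolution P s T ψ)
    (hPs : ∀ t ∈ Icc 0 T, (P t).IsSymm) {t : ℝ} (ht : t ∈ Icc 0 T) :
    (ψ t)ᵀ * J (Fin n) ℝ * ψ t = J (Fin n) ℝ := by
  have hd : ∀ i j, ∀ t ∈ Icc 0 T,
      HasDerivWithinAt (fun r => ((ψ r)ᵀ * J (Fin n) ℝ * ψ r) i j) 0 (Icc 0 T) t := by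
    intro i j t ht
    have h1 := hasDerivWithinAt_dotProduct (u := fun r => (ψ r).col i)
      (v := fun r => J (Fin n) ℝ *ᵥ (ψ r).col j) (fun k => hψ.2 t ht k i)
      (hasDerivWithinAt_mulVec (M' := 0) (fun k l => hasDerivWithinAt_const _ _ _)
        fun k => hψ.2 t ht k j)
    have h2 : ∀ r, (ψ r).col i ⬝ᵥ (J (Fin n) ℝ *ᵥ (ψ r).col j) =
        ((ψ r)ᵀ * J (Fin n) ℝ * ψ r) i j := fun r => by
      rw [Matrix.mul_assoc]
      rfl
    simp only [h2] at h1
    refine h1.congr_deriv ?_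
    have h3 : (J (Fin n) ℝ * hamMatrix P s t * ψ t)ᵀ * J (Fin n) ℝ * ψ t +
        (ψ t)ᵀ * J (Fin n) ℝ * (J (Fin n) ℝ * hamMatrix P s t * ψ t) = 0 := by
      rw [transpose_mul, transpose_mul, (hamMatrix_isSymm (hPs t ht)).eq, J_transpose]
      simp only [Matrix.mul_assoc, Matrix.neg_mul, Matrix.mul_neg]
      rw [← Matrix.mul_assoc (J (Fin n) ℝ) (J (Fin n) ℝ), J_squared]
      rw [← Matrix.mul_assoc (J (Fin n) ℝ) (J (Fin n) ℝ), J_squared]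
      simp
    rw [zero_mulVec, zero_add]
    have h4 := congrFun (congrFun h3 i) j
    rw [Matrix.mul_assoc, Matrix.mul_assoc (ψ t)ᵀ] at h4
    exact h4
  ext i j
  have h0 : (0 : ℝ) ≤ T := ht.1.trans ht.2
  have := constant_of_has_deriv_right_zero (fun t ht => (hd i j t ht).continuousWithinAt)
    (fun t ht => (hd i j t (Ico_subset_Icc_self ht)).mono_of_mem_nhdsWithin
      (Icc_mem_nhdsGE_of_mem ht)) t ht
  rw [this, hψ.1]
  simp

/-- The real form `⟨y, P x⟩`. -/
def realForm (P : Matrix (Fin n) (Fin n) ℝ) (z : Ph n → ℝ) : ℝ :=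
  (z ∘ Sum.inl) ⬝ᵥ (P *ᵥ (z ∘ Sum.inr))

theorem cplx_mulVec_re {κ μ : Type*} [Fintype μ] (M : Matrix κ μ ℝ) (z : μ → ℂ) :
    (fun i => ((cplx M *ᵥ z) i).re) = M *ᵥ fun i => (z i).re := by
  ext i; simp [mulVec, dotProduct]

theorem cplx_mulVec_im {κ μ : Type*} [Fintype μ] (M : Matrix κ μ ℝ) (z : μ → ℂ) :
    (fun i => ((cplx M *ᵥ z) i).im) = M *ᵥ fun i => (z i).im := by
  ext i; simp [mulVec, dotProduct]

theorem coneForm_eq_add (P : Matrix (Fin n) (Fin n) ℝ) (z : Ph n → ℂ) :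
    coneForm P z = realForm P (fun i => (z i).re) + realForm P (fun i => (z i).im) := by
  have h1 := cplx_mulVec_re P (z ∘ Sum.inr)
  have h2 := cplx_mulVec_im P (z ∘ Sum.inr)
  have h3 : realForm P (fun i => (z i).re) =
      ∑ i, (z (Sum.inl i)).re * ((cplx P *ᵥ (z ∘ Sum.inr)) i).re :=
    Finset.sum_congr (s₁ := Finset.univ) rfl fun i _ =>
      congrArg ((z (Sum.inl i)).re * ·) (congrFun h1 i).symm
  have h4 : realForm P (fun i => (z i).im) =
      ∑ i, (z (Sum.inl i)).im * ((cplx P *ᵥ (z ∘ Sum.inr)) i).im :=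
    Finset.sum_congr (s₁ := Finset.univ) rfl fun i _ =>
      congrArg ((z (Sum.inl i)).im * ·) (congrFun h2 i).symm
  rw [h3, h4, ← Finset.sum_add_distrib, coneForm, dotProduct, Complex.re_sum]
  refine Finset.sum_congr rfl fun i _ => ?_
  simp

theorem isExpanding_of_real {P₀ P : Matrix (Fin n) (Fin n) ℝ} {M : Matrix (Ph n) (Ph n) ℝ}
    (h : ∀ c : Ph n → ℝ, c ≠ 0 → realForm P₀ c < realForm P (M *ᵥ c)) : IsExpanding P₀ P M := by
  have h0 : ∀ c : Ph n → ℝ, realForm P₀ c ≤ realForm P (M *ᵥ c) := fun c => by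
    rcases eq_or_ne c 0 with rfl | hc
    · simp [realForm, Pi.zero_comp]
    · exact (h c hc).le
  intro z hz
  rw [coneForm_eq_add, coneForm_eq_add, cplx_mulVec_re, cplx_mulVec_im]
  by_cases hre : (fun i => (z i).re) = 0
  · refine add_lt_add_of_le_of_lt (h0 _) (h _ fun him => hz ?_)
    ext i
    exact Complex.ext (congrFun hre i) (congrFun him i)
  · exact add_lt_add_of_lt_of_le (h _ hre) (h0 _)

/-- The quadratic estimate behind the choice of the threshold for `s`: a bilinear term with
coefficients bounded by `C` is dominated by `|y|² + s |w|²`. -/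
theorem quadratic_pos {E : Matrix (Fin n) (Fin n) ℝ} {C s : ℝ} (hE : ∀ i j, |E i j| ≤ C)
    (hs : C ^ 2 * (n + 1) ^ 2 / 2 + 1 ≤ s) {y w : Fin n → ℝ} (h : y ≠ 0 ∨ w ≠ 0) :
    0 < s * (w ⬝ᵥ w) + y ⬝ᵥ y + y ⬝ᵥ (E *ᵥ w) := by
  set Y := ∑ i, |y i| with hY
  set W := ∑ i, |w i| with hW
  have hsq : ∀ v : Fin n → ℝ, (∑ i, |v i|) ^ 2 ≤ n * (v ⬝ᵥ v) := fun v => by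
    have := sq_sum_le_card_mul_sum_sq (s := Finset.univ) (f := fun i => |v i|)
    simpa [dotProduct, sq_abs, ← sq] using this
  have hnn : ∀ v : Fin n → ℝ, 0 ≤ v ⬝ᵥ v := fun v =>
    Finset.sum_nonneg fun i _ => mul_self_nonneg _
  have hlow : -(C * (Y * W)) ≤ y ⬝ᵥ (E *ᵥ w) := by
    refine (neg_le_neg ?_).trans (neg_abs_le _)
    calc |y ⬝ᵥ (E *ᵥ w)| ≤ ∑ i, |y i * ∑ j, E i j * w j| := Finset.abs_sum_le_sum_abs _ _
      _ ≤ ∑ i, |y i| * (C * W) := by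
          refine Finset.sum_le_sum fun i _ => ?_
          rw [abs_mul]
          refine mul_le_mul_of_nonneg_left ?_ (abs_nonneg _)
          refine (Finset.abs_sum_le_sum_abs _ _).trans ?_
          rw [hW, Finset.mul_sum]
          refine Finset.sum_le_sum fun j _ => ?_
          rw [abs_mul]
          exact mul_le_mul_of_nonneg_right (hE i j) (abs_nonneg _)
      _ = C * (Y * W) := by rw [← Finset.sum_mul]; ring
  have hN : (0 : ℝ) < n + 1 := by positivity
  have hyoung : C * (Y * W) ≤ Y ^ 2 / (2 * (n + 1)) + C ^ 2 * (n + 1) / 2 * W ^ 2 := by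
    have h1 : Y ^ 2 / (2 * (n + 1)) + C ^ 2 * (n + 1) / 2 * W ^ 2 - C * (Y * W) =
        (Y - C * (n + 1) * W) ^ 2 / (2 * (n + 1)) := by
      field_simp
      ring
    have h2 : 0 ≤ (Y - C * (n + 1) * W) ^ 2 / (2 * ((n : ℝ) + 1)) := by positivity
    linarith
  have hY2 : Y ^ 2 / (2 * (n + 1)) ≤ (y ⬝ᵥ y) / 2 := by
    rw [div_le_div_iff₀ (by positivity) (by positivity)]
    nlinarith [hsq y, hnn y]
  have hW2 : C ^ 2 * (n + 1) / 2 * W ^ 2 ≤ C ^ 2 * (n + 1) ^ 2 / 2 * (w ⬝ᵥ w) := by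
    have h1 : W ^ 2 ≤ (n + 1) * (w ⬝ᵥ w) := by nlinarith [hsq w, hnn w]
    calc C ^ 2 * (n + 1) / 2 * W ^ 2 ≤ C ^ 2 * (n + 1) / 2 * ((n + 1) * (w ⬝ᵥ w)) :=
          mul_le_mul_of_nonneg_left h1 (by positivity)
      _ = _ := by ring
  have hsw : (C ^ 2 * (n + 1) ^ 2 / 2 + 1) * (w ⬝ᵥ w) ≤ s * (w ⬝ᵥ w) :=
    mul_le_mul_of_nonneg_right hs (hnn w)
  have hpos : 0 < (y ⬝ᵥ y) / 2 + w ⬝ᵥ w := by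
    have hne : ∀ v : Fin n → ℝ, v ≠ 0 → 0 < v ⬝ᵥ v := fun v hv =>
      (hnn v).lt_of_ne fun h0 => hv (dotProduct_self_eq_zero.1 h0.symm)
    rcases h with h | h
    · linarith [hne y h, hnn w]
    · linarith [hne w h, hnn y]
  linarith

/-- Along the flow `d/dt ⟨y, P x⟩ = |y|² + s |P x|² + ⟨y, P' x⟩`, which is positive for
large `s`. -/
theorem exists_threshold_isExpanding (hT : 0 < T)
    (hPreg : ∀ i j, ContDiffOn ℝ 1 (fun t => P t i j) (Icc 0 T))
    (hPs : ∀ t ∈ Icc 0 T, (P t).IsSymm) (hdet : ∀ t ∈ Icc 0 T, (P t).det ≠ 0) :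
    ∃ σ : ℝ, ∀ s, σ ≤ s → ∀ ψ : ℝ → Matrix (Ph n) (Ph n) ℝ, IsFundamentalSolution P s T ψ →
      ∀ t ∈ Ioc 0 T, IsExpanding (P 0) (P t) (ψ t) := by
  have hPc : ContinuousOn P (Icc 0 T) :=
    continuousOn_pi.2 fun i => continuousOn_pi.2 fun j => (hPreg i j).continuousOn
  let P' : ℝ → Matrix (Fin n) (Fin n) ℝ := fun t => of fun i j =>
    derivWithin (fun t => P t i j) (Icc 0 T) t
  have hP' : ∀ i j, ∀ t ∈ Icc 0 T,
      HasDerivWithinAt (fun t => P t i j) (P' t i j) (Icc 0 T) t := fun i j t ht =>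
    (((hPreg i j).differentiableOn one_ne_zero) t ht).hasDerivWithinAt
  have hE : ∀ i j, ContinuousOn (fun t => (P' t * (P t)⁻¹) i j) (Icc 0 T) := fun i j =>
    continuousOn_finsetSum Finset.univ fun k _ => ContinuousOn.mul (f := fun t => P' t i k)
      ((hPreg i k).continuousOn_derivWithin (uniqueDiffOn_Icc hT) le_rfl)
      (continuousOn_inv_apply hPc hdet k j)
  obtain ⟨D, -, hCD⟩ := exists_forall_abs_apply_le hE
  refine ⟨D ^ 2 * (n + 1) ^ 2 / 2 + 1, fun s hs ψ hψ t ht => isExpanding_of_real fun c hc => ?_⟩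
  set z : ℝ → Ph n → ℝ := fun t => ψ t *ᵥ c with hz
  have hzd : ∀ t ∈ Icc 0 T, ∀ i, HasDerivWithinAt (fun r => z r i)
      ((fromBlocks 0 (s • P t) (P t)⁻¹ 0 *ᵥ z t) i) (Icc 0 T) t := by
    intro t ht i
    have := hasDerivWithinAt_mulVec (v := fun _ => c) (v' := 0) (hψ.2 t ht)
      (fun i => hasDerivWithinAt_const _ _ _) i
    rwa [mulVec_zero, add_zero, ← mulVec_mulVec, J_mul_hamMatrix] at this
  have hzne : ∀ t ∈ Icc 0 T, z t ≠ 0 := by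
    intro t ht h0
    have h1 : J (Fin n) ℝ *ᵥ c = 0 := by
      rw [← hψ.transpose_mul_J_mul hPs ht, ← mulVec_mulVec]
      simp only [hz] at h0
      rw [h0, mulVec_zero]
    have h2 := congrArg (J (Fin n) ℝ *ᵥ ·) h1
    rw [mulVec_mulVec, J_squared] at h2
    simp only [neg_mulVec, one_mulVec, mulVec_zero, neg_eq_zero] at h2
    exact hc h2
  have hfd : ∀ t ∈ Icc 0 T, ∃ d, 0 < d ∧
      HasDerivWithinAt (fun r => realForm (P r) (z r)) d (Icc 0 T) t := by
    intro t ht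
    have hu : IsUnit (P t).det := (hdet t ht).isUnit
    set y := z t ∘ Sum.inl with hy
    set x := z t ∘ Sum.inr with hx
    have hy' : ∀ i, HasDerivWithinAt (fun r => (z r ∘ Sum.inl) i) (((s • P t) *ᵥ x) i)
        (Icc 0 T) t := by
      intro i
      have := hzd t ht (Sum.inl i)
      rwa [fromBlocks_mulVec, Sum.elim_inl, zero_mulVec, zero_add] at this
    have hx' : ∀ i, HasDerivWithinAt (fun r => (z r ∘ Sum.inr) i) (((P t)⁻¹ *ᵥ y) i)
        (Icc 0 T) t := by
      intro i
      have := hzd t ht (Sum.inr i)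
      rwa [fromBlocks_mulVec, Sum.elim_inr, zero_mulVec, add_zero] at this
    refine ⟨_, ?_, hasDerivWithinAt_dotProduct hy'
      (hasDerivWithinAt_mulVec (fun i j => hP' i j t ht) hx')⟩
    have hPx : (P t)⁻¹ *ᵥ (P t *ᵥ x) = x := by
      rw [mulVec_mulVec, nonsing_inv_mul _ hu, one_mulVec]
    have h1 : P' t *ᵥ x = (P' t * (P t)⁻¹) *ᵥ (P t *ᵥ x) := by
      rw [← mulVec_mulVec, hPx]
    have h2 : y ≠ 0 ∨ P t *ᵥ x ≠ 0 := by
      by_contra! h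
      refine hzne t ht (funext fun i => ?_)
      rcases i with i | i
      · exact congrFun h.1 i
      · have : x = 0 := by rw [← hPx, h.2, mulVec_zero]
        exact congrFun this i
    have h3 := quadratic_pos (hCD t ht) hs h2
    have h4 : z t ∘ Sum.inr = x := rfl
    have h5 : z t ∘ Sum.inl = y := rfl
    rw [h4, h5, h1, mulVec_mulVec y, mul_nonsing_inv _ hu, one_mulVec, smul_mulVec,
      smul_dotProduct, dotProduct_add, smul_eq_mul]
    linarith
  have hmono : StrictMonoOn (fun r => realForm (P r) (z r)) (Icc 0 T) := by
    refine strictMonoOn_of_deriv_pos (convex_Icc 0 T) (fun t ht => ?_) fun t ht => ?_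
    · obtain ⟨d, -, hd⟩ := hfd t ht
      exact hd.continuousWithinAt
    · rw [interior_Icc] at ht
      obtain ⟨d, hd0, hd⟩ := hfd t (Ioo_subset_Icc_self ht)
      rwa [(hd.hasDerivAt (Icc_mem_nhds ht.1 ht.2)).deriv]
  have := hmono (left_mem_Icc.2 hT.le) (Ioc_subset_Icc_self ht) ht.1
  simpa [hz, hψ.1] using this

end Fundamental

/-! ### Endpoints -/

section Endpoints

/-- The Cayley transform `(M + 1) (M - 1)⁻¹` of a symplectic matrix is `H J` with `H` symmetric. -/
theorem exists_isSymm_cayley {ι : Type*} [Fintype ι] [DecidableEq ι]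
    {M : Matrix (ι ⊕ ι) (ι ⊕ ι) ℝ} (hM : Mᵀ * J ι ℝ * M = J ι ℝ) (hdet : (M - 1).det ≠ 0) :
    ∃ H : Matrix (ι ⊕ ι) (ι ⊕ ι) ℝ, H.IsSymm ∧ M + 1 = H * J ι ℝ * (M - 1) := by
  have hu : IsUnit (M - 1).det := hdet.isUnit
  have hut : IsUnit (M - 1)ᵀ.det := by rwa [det_transpose]
  set X := (M - 1)⁻¹ with hX
  have hJ : J ι ℝ * J ι ℝ = -1 := J_squared ι ℝ
  refine ⟨-((M + 1) * X * J ι ℝ), ?_, ?_⟩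
  · -- multiplying by the invertible matrices `(M - 1)ᵀ J` and `J (M - 1)` reduces the symmetry
    -- to an identity that follows from `Mᵀ J M = J`
    have h1 : (M - 1)ᵀ * J ι ℝ * (M + 1) = -((M + 1)ᵀ * J ι ℝ * (M - 1)) := by
      simp only [transpose_sub, transpose_add, transpose_one, sub_mul, add_mul, mul_sub, mul_add,
        one_mul, mul_one, hM]
      abel
    have h2 : J ι ℝ * (M + 1) * X = -((M - 1)ᵀ⁻¹ * (M + 1)ᵀ * J ι ℝ) := by
      calc J ι ℝ * (M + 1) * X = (M - 1)ᵀ⁻¹ * ((M - 1)ᵀ * J ι ℝ * (M + 1)) * X := by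
            simp only [← mul_assoc, nonsing_inv_mul _ hut, one_mul]
        _ = -((M - 1)ᵀ⁻¹ * (M + 1)ᵀ * J ι ℝ * ((M - 1) * X)) := by
            rw [h1]; simp only [mul_neg, neg_mul, mul_assoc]
        _ = _ := by rw [hX, mul_nonsing_inv _ hu, mul_one]
    have h3 : (M + 1) * X = J ι ℝ * ((M - 1)ᵀ⁻¹ * (M + 1)ᵀ * J ι ℝ) := by
      calc (M + 1) * X = -(J ι ℝ * J ι ℝ) * ((M + 1) * X) := by rw [hJ]; simp
        _ = -(J ι ℝ * (J ι ℝ * (M + 1) * X)) := by simp only [neg_mul, mul_assoc]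
        _ = _ := by rw [h2]; simp
    have h4 : Xᵀ = (M - 1)ᵀ⁻¹ := by rw [hX, transpose_nonsing_inv]
    have h5 : (M + 1) * X * J ι ℝ = -(J ι ℝ * ((M - 1)ᵀ⁻¹ * (M + 1)ᵀ)) := by
      rw [h3]
      simp only [mul_assoc, hJ, mul_neg, mul_one]
    rw [IsSymm, transpose_neg, transpose_mul, transpose_mul, h4, J_transpose, h5, neg_mul]
  · rw [neg_mul, mul_assoc ((M + 1) * X), hJ, mul_neg, mul_one, neg_neg, mul_assoc, hX,
      nonsing_inv_mul _ hu, mul_one]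

theorem exists_diagonalization_cplx {κ : Type*} [Fintype κ] [DecidableEq κ] {H : Matrix κ κ ℝ}
    (hH : H.IsSymm) : ∃ (U V : Matrix κ κ ℂ) (h : κ → ℝ), V * U = 1 ∧
      cplx H = U * diagonal (fun j => (h j : ℂ)) * V := by
  have hc : (cplx H).IsHermitian := by
    rw [IsHermitian, conjTranspose_cplx, hH.eq]
  refine ⟨hc.eigenvectorUnitary, star (hc.eigenvectorUnitary : Matrix κ κ ℂ), hc.eigenvalues,
    Unitary.coe_star_mul_self _, ?_⟩
  conv_lhs => rw [hc.spectral_theorem, Unitary.conjStarAlgAut_apply]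
  rfl

theorem arg_exp_mul_I_of_mem {θ : ℝ} (h1 : -Real.pi < θ) (h2 : θ ≤ Real.pi) :
    (Complex.exp (θ * Complex.I)).arg = θ := by
  rw [← Complex.log_im, Complex.log_exp (by simpa using h1) (by simpa using h2)]
  simp

theorem div_eq_exp_arg (h : ℝ) : (1 + Complex.I * h) / (1 - Complex.I * h) =
    Complex.exp ((2 * (1 + Complex.I * h : ℂ).arg : ℝ) * Complex.I) := by
  set w : ℂ := 1 + Complex.I * h with hw
  have hw0 : w ≠ 0 := fun hc => by
    have := congrArg Complex.re hc
    simp [hw] at this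
  have hconj : 1 - Complex.I * h = starRingEnd ℂ w := by simp [hw, sub_eq_add_neg]
  have hn : (‖w‖ : ℂ) ≠ 0 := by simpa using hw0
  have h1 : starRingEnd ℂ w = ‖w‖ * Complex.exp (-(w.arg * Complex.I)) := by
    conv_lhs => rw [← Complex.norm_mul_exp_arg_mul_I w]
    rw [map_mul, Complex.conj_ofReal, ← Complex.exp_conj]
    simp
  rw [hconj, h1]
  nth_rw 1 [← Complex.norm_mul_exp_arg_mul_I w]
  rw [mul_div_mul_left _ _ hn, ← Complex.exp_sub]
  congr 1
  push_cast
  ring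

/-- For small `ε > 0` the rotation by `-2 ε` moves no argument across the cut. -/
theorem eventually_arg_eq (h : ℝ) : ∀ᶠ ε : ℝ in 𝓝[>] 0,
    (Complex.exp (-(2 * ε * Complex.I)) * ((1 + Complex.I * h) / (1 - Complex.I * h))).arg =
      2 * (1 + Complex.I * h : ℂ).arg - 2 * ε := by
  set α := (1 + Complex.I * h : ℂ).arg with hα
  have hα' : |α| < Real.pi / 2 := Complex.abs_arg_lt_pi_div_two_iff.2 (Or.inl (by simp))
  obtain ⟨h1, h2⟩ := abs_lt.1 hα'
  have h3 : ∀ᶠ ε : ℝ in 𝓝[>] 0, ε < α + Real.pi / 2 :=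
    nhdsWithin_le_nhds (eventually_lt_nhds (by linarith))
  filter_upwards [h3, self_mem_nhdsWithin] with ε hε hε0
  have hε0 : 0 < ε := hε0
  rw [div_eq_exp_arg, ← hα, ← Complex.exp_add,
    ← arg_exp_mul_I_of_mem (θ := 2 * α - 2 * ε) (by linarith) (by linarith)]
  congr 2
  push_cast
  ring

variable {n : ℕ}

theorem rotMatrix_eq_fromBlocks (ε : ℝ) : rotMatrix n ε =
    fromBlocks (Real.cos ε • 1 + Real.sin ε • J (Fin n) ℝ) 0 0
      (Real.cos ε • 1 - Real.sin ε • J (Fin n) ℝ) := by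
  simp [rotMatrix, dblJ, ← fromBlocks_one, fromBlocks_smul, sub_eq_add_neg, fromBlocks_neg,
    fromBlocks_add]

theorem rotateBack_graphOf_inf_eq_bot {ε : ℝ} {M : Matrix (Ph n) (Ph n) ℝ}
    (h : (Real.cos ε • (M - 1) - Real.sin ε • (J (Fin n) ℝ * (M + 1))).det ≠ 0) :
    rotateBack ε (graphOf M) ⊓ graphOf 1 = ⊥ := by
  rw [eq_bot_iff]
  rintro z ⟨h1, h2⟩
  rw [SetLike.mem_coe, rotateBack_graphOf, mem_range_toEuclideanLin] at h1
  obtain ⟨w, hw⟩ := h1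
  obtain ⟨v, hv⟩ := mem_range_toEuclideanLin.1 h2
  have h3 : z.ofLp ∘ Sum.inl = z.ofLp ∘ Sum.inr := by
    rw [← hv, fromRows_mulVec]; rfl
  rw [← hw, graphFrame, rotMatrix_eq_fromBlocks, fromBlocks_mul_fromRows, fromRows_mulVec] at h3
  have h4 : ((Real.cos ε • 1 + Real.sin ε • J (Fin n) ℝ) : Matrix (Ph n) (Ph n) ℝ) *ᵥ w =
      ((Real.cos ε • 1 - Real.sin ε • J (Fin n) ℝ) * M) *ᵥ w := by
    simpa using h3
  have h5 : (Real.cos ε • (M - 1) - Real.sin ε • (J (Fin n) ℝ * (M + 1))) *ᵥ w = 0 := by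
    have h6 : Real.cos ε • (M - 1) - Real.sin ε • (J (Fin n) ℝ * (M + 1)) =
        (Real.cos ε • 1 - Real.sin ε • J (Fin n) ℝ) * M -
          (Real.cos ε • 1 + Real.sin ε • J (Fin n) ℝ) := by
      simp only [sub_mul, smul_mul_assoc, one_mul, mul_add, mul_one]
      module
    rw [h6, sub_mulVec, h4, sub_self]
  have h6 : w = 0 := by
    by_contra hw0
    exact h (exists_mulVec_eq_zero_iff.1 ⟨w, hw0, h5⟩)
  rw [h6, mulVec_zero] at hw
  rw [Submodule.mem_bot]
  exact (WithLp.ofLp_eq_zero 2).1 hw.symm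

theorem eventually_rotateBack_graphOf_inf_eq_bot {M : Matrix (Ph n) (Ph n) ℝ}
    (hM : (M - 1).det ≠ 0) :
    ∀ᶠ ε : ℝ in 𝓝[>] 0, rotateBack ε (graphOf M) ⊓ graphOf 1 = ⊥ := by
  have hc : Continuous fun ε : ℝ =>
      (Real.cos ε • (M - 1) - Real.sin ε • (J (Fin n) ℝ * (M + 1))).det :=
    ((Real.continuous_cos.smul continuous_const).sub
      (Real.continuous_sin.smul continuous_const)).matrix_det
  have h0 := hc.continuousAt.eventually_ne (x := 0) (y := 0) (by simpa using hM)
  exact nhdsWithin_le_nhds (h0.mono fun ε hε => rotateBack_graphOf_inf_eq_bot hε)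

theorem eventually_rotateBack_graphOf_one_inf_eq_bot :
    ∀ᶠ ε : ℝ in 𝓝[>] 0, rotateBack ε (graphOf (n := n) 1) ⊓ graphOf 1 = ⊥ := by
  have h3 : ∀ᶠ ε : ℝ in 𝓝[>] 0, ε < Real.pi :=
    nhdsWithin_le_nhds (eventually_lt_nhds Real.pi_pos)
  filter_upwards [h3, self_mem_nhdsWithin] with ε hε hε0
  have hs := (Real.sin_pos_of_pos_of_lt_pi hε0 hε).ne'
  refine rotateBack_graphOf_inf_eq_bot ?_
  have h1 : Real.cos ε • ((1 : Matrix (Ph n) (Ph n) ℝ) - 1) -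
      Real.sin ε • (J (Fin n) ℝ * (1 + 1)) = (-(2 * Real.sin ε)) • J (Fin n) ℝ := by
    rw [mul_add, mul_one]
    module
  rw [h1, det_smul]
  exact mul_ne_zero (pow_ne_zero _ (neg_ne_zero.2 (mul_ne_zero two_ne_zero hs)))
    (isUnit_det_J (Fin n) ℝ).ne_zero

theorem eventually_argSum_souriau_one : ∀ᶠ ε : ℝ in 𝓝[>] 0,
    argSum (souriau (graphOf 1) (rotateBack ε (graphOf (n := n) 1))) =
      2 * n * (Real.pi - 2 * ε) := by
  have h3 : ∀ᶠ ε : ℝ in 𝓝[>] 0, ε < Real.pi :=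
    nhdsWithin_le_nhds (eventually_lt_nhds Real.pi_pos)
  filter_upwards [h3, self_mem_nhdsWithin] with ε hε hε0
  have hε0 : 0 < ε := hε0
  have harg : (Complex.exp (-(2 * ε * Complex.I)) * (-1)).arg = Real.pi - 2 * ε := by
    rw [← Complex.exp_pi_mul_I, ← Complex.exp_add,
      ← arg_exp_mul_I_of_mem (θ := Real.pi - 2 * ε) (by linarith) (by linarith)]
    congr 2
    push_cast
    ring
  rw [argSum_souriau ε (U := 1) (V := 1) (d := fun _ => -1) (by simp) (one_mul 1) ?_ ?_]
  · simp only [harg]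
    simp
    ring
  · rw [holoPart_one, antiholoPart_one, one_mul, mul_one, mul_one]
    ext i j
    by_cases hij : i = j <;> simp [hij]
  · rw [antiholoPart_one, det_one]
    exact isUnit_one

/-- A path of symplectic matrices from the identity, with nondegenerate endpoint, has index `n` if
the argument of `det (holoPart (ψ t))` increases by `∑ arg (1 + i h j)`, where the `h j` are the
eigenvalues of `H`, for the Cayley transform `H J` of the endpoint. -/
theorem hasCLMIndex_of_log {T : ℝ} (hT : 0 ≤ T) {ψ : ℝ → Matrix (Ph n) (Ph n) ℝ}
    (hψc : ContinuousOn ψ (Icc 0 T)) (hψ0 : ψ 0 = 1)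
    (hψs : ∀ t ∈ Icc 0 T, (ψ t)ᵀ * J (Fin n) ℝ * ψ t = J (Fin n) ℝ)
    (hdet : (ψ T - 1).det ≠ 0) {H : Matrix (Ph n) (Ph n) ℝ}
    (hH : ψ T + 1 = H * J (Fin n) ℝ * (ψ T - 1)) {U V : Matrix (Ph n) (Ph n) ℂ} {h : Ph n → ℝ}
    (hVU : V * U = 1) (hUV : cplx H = U * diagonal (fun j => (h j : ℂ)) * V) {g : ℝ → ℂ}
    (hgc : ContinuousOn g (Icc 0 T))
    (hg : ∀ t ∈ Icc 0 T, Complex.exp (g t) = (holoPart (ψ t)).det)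
    (hgT : (g T - g 0).im = ∑ j, (1 + Complex.I * h j).arg) (hg0 : (g 0).im = 0) :
    HasCLMIndex (graphOf 1) (fun t => graphOf (ψ t)) 0 T n := by
  have h0 : (0 : ℝ) ∈ Icc 0 T := left_mem_Icc.2 hT
  have hTT : T ∈ Icc 0 T := right_mem_Icc.2 hT
  have hne : ∀ t ∈ Icc 0 T, (holoPart (ψ t)).det ≠ 0 := fun t ht => by
    rw [← hg t ht]
    exact Complex.exp_ne_zero _
  have hanti : IsUnit (antiholoPart (ψ T)).det := by
    rw [det_antiholoPart, isUnit_iff_ne_zero]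
    exact (map_ne_zero _).2 (hne T hTT)
  filter_upwards [eventually_rotateBack_graphOf_inf_eq_bot hdet,
    eventually_rotateBack_graphOf_one_inf_eq_bot (n := n), eventually_argSum_souriau_one (n := n),
    eventually_all.2 fun j => eventually_arg_eq (h j)] with ε htrans htrans0 harg0 harg
  refine ⟨?_, isLagrangianPath_rotateBack_graphOf hψc hψs ε, ?_, htrans,
    fun t => 2 * (g t).im - 4 * n * ε, ?_, fun t ht => ?_, ?_⟩
  · have := (isLagrangianFrame_graphFrame (n := n) 0 (M := 1) (by simp)).isLagrangian_range
    rwa [graphFrame_zero] at this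
  · simpa only [hψ0] using htrans0
  · exact (continuousOn_const.mul (Complex.continuous_im.comp_continuousOn hgc)).sub
      continuousOn_const
  · have h1 : g t - starRingEnd ℂ (g t) = 2 * (g t).im * Complex.I := by
      rw [Complex.sub_conj]
      push_cast
      ring
    rw [det_souriau ε (hψs t ht) (hne t ht), ← hg t ht, ← Complex.exp_conj, ← Complex.exp_sub, h1,
      ← Complex.exp_add]
    congr 1
    push_cast
    ring
  · have h1 : argSum (souriau (graphOf 1) (rotateBack ε (graphOf (ψ T)))) =
        2 * (g T - g 0).im - 4 * n * ε := by
      rw [argSum_souriau ε (hψs T hTT) hVU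
        (neg_holoPart_eq_of_diagonalization hH hVU hUV) hanti, hgT,
        Finset.sum_congr rfl fun j _ => harg j, Finset.sum_sub_distrib, Finset.mul_sum]
      simp
      ring
    simp only [h1, hψ0, harg0]
    rw [Complex.sub_im, hg0]
    push_cast
    ring

end Endpoints

end

theorem mainTheorem4 (n : ℕ) (T : ℝ) (hT : 0 < T) (P : ℝ → Matrix (Fin n) (Fin n) ℝ)
    (hPreg : ∀ i j, ContDiffOn ℝ 1 (fun t => P t i j) (Icc 0 T))
    (hPsymm : ∀ t ∈ Icc 0 T, (P t).IsSymm)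
    (hPdet : ∀ t ∈ Icc 0 T, (P t).det ≠ 0)
    (hPper : P 0 = P T) :
    ∃ σ : ℝ, ∀ s₀ : ℝ, σ ≤ s₀ →
      (∃ ψ : ℝ → Matrix (Ph n) (Ph n) ℝ, IsFundamentalSolution P s₀ T ψ) ∧
      ∀ ψ : ℝ → Matrix (Ph n) (Ph n) ℝ, IsFundamentalSolution P s₀ T ψ →
        HasCLMIndex (graphOf 1) (fun t => graphOf (ψ t)) 0 T n := by
  have hPc : ContinuousOn P (Icc 0 T) :=
    continuousOn_pi.2 fun i => continuousOn_pi.2 fun j => (hPreg i j).continuousOn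
  have hT0 : (0 : ℝ) ∈ Icc 0 T := left_mem_Icc.2 hT.le
  obtain ⟨σ, hσ⟩ := exists_threshold_isExpanding hT hPreg hPsymm hPdet
  refine ⟨σ, fun s hs => ⟨exists_isFundamentalSolution hT hPc hPdet s, fun ψ hψ => ?_⟩⟩
  have hexp := hσ s hs ψ hψ
  have hsymp := fun t (ht : t ∈ Icc 0 T) => hψ.transpose_mul_J_mul hPsymm ht
  have hdet : (ψ T - 1).det ≠ 0 := by
    have := hexp T ⟨hT, le_rfl⟩
    rw [← hPper] at this
    exact this.det_sub_one_ne_zero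
  obtain ⟨H, hHs, hH⟩ := exists_isSymm_cayley (hsymp T (right_mem_Icc.2 hT.le)) hdet
  obtain ⟨U, V, h, hVU, hUV⟩ := exists_diagonalization_cplx hHs
  obtain ⟨g, hgc, hg, hgT⟩ := exists_log_det_pairMatrix hT hPc hPsymm (hPdet 0 hT0) hPper
    hψ.continuousOn hψ.1 hexp hH hVU hUV
  have hg0 := hg 0 hT0
  rw [hψ.1, cplx_one] at hg0
  refine hasCLMIndex_of_log (g := fun t => g t - g 0) hT.le hψ.continuousOn hψ.1 hsymp hdet hH hVU
    hUV (hgc.sub continuousOn_const) (fun t ht => ?_) (by simpa using hgT) (by simp)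
  rw [Complex.exp_sub, hg t ht, hg0, pairMatrix_I_eq, Matrix.det_mul]
  refine mul_div_cancel_left₀ _ ?_
  rw [← hg0]
  exact Complex.exp_ne_zero _
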